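/- **Words.** An alphabet consists of positive letters $x_i$ and their formal inverses $x_i^{-1}$; its size counts both. Let $A=\{a_0^{\pm1},a_1^{\pm1},\dots\}$, and let $B$ be an alphabet of size $80$ ($40$ positive letters and their inverses). Words are elements of the free monoids $A^*$, $B^*$; $[w]$ denotes the set of cyclic permutations of $w$ (the cyclic word of $w$), and a factor of $[w]$ is a subword of some element of $[w]$. A word is cyclically reduced if no element of $[w]$ contains a subword $xx^{-1}$, $x$ a letter. A word is square free if it has no subword $uu$ with $u$ non-empty. **Wicks forms.** An orientable Wicks form is a cyclic word $[u]$ over $A$ such that (i) if a letter $x$ occurs in $u$, then $x^{-1}$ occurs exactly once in $u$; (ii) $u$ is cyclically reduced; (iii) if $xy$ ($x,y$ letters) is a factor of $[u]$, then $y^{-1}x^{-1}$ is not. If $u$ has length $2e$, its genus $g$ is the genus of the closed oriented surface obtained from a $2e$-gon with boundary labelled by $u$ by identifying sides with the same label; thus $2-2g=v-e+1$, where $v$ is the number of vertices after identification. A Wicks form of genus $g$ is maximal if its length is $6(2g-1)$. Two Wicks forms $[u],[u']$ are isomorphic if there is a bijection $\varphi:A\to A$ with $\varphi(x^{-1})=\varphi(x)^{-1}$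 for every letter $x$ and $[\varphi(u)]=[u']$. **Representations.** Let $\Phi:A\to B^*$ be a map with every $\Phi(a_i)$ freely reduced and $\Phi(a_i^{-1})=\Phi(a_i)^{-1}$, extended to $A^*\to B^*$. For a Wicks form $[u]$ of genus $g$, $(\Phi,u)$ is a genus $g$ Wicks representation of $w\in B^*$ if, for some $u'\in[u]$, $w$ is the free reduction of $\Phi(u')$; it is non-cancelling if moreover $\Phi(u)$ is cyclically reduced. A word $w\in B^*$ has genus $g$ if it has a non-cancelling genus $g$ Wicks representation but no Wicks representation of genus less than $g$. $M(g,w)$ is the number of isomorphism classes $I$ of maximal Wicks forms of genus $g$ such that $w$ has a non-cancelling Wicks representation $(\Phi,u)$ with $u\in I$. **Corollary.** There is a sequence $w_2,w_3,w_4,\dots$ of words over the alphabet $B$ of size $80$ such that, for every $g\ge 2$, 1. $w_g$ is square free, and so is every cyclic permutation of $w_g$; 2. $w_g$ has genus $g$; 3. if $g>10^{17}$, then $M(g,w_g)>g!$. -/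

import Mathlib

namespace Wicks

/-- The alphabet with positive letters `α`: the letter `(a, true)` is `a` and `(a, false)` is
`a⁻¹`.  Words over it are lists, as in Mathlib's free groups. -/
abbrev Letter (α : Type*) := α × Bool

/-- The fixed-point free involution `a ↦ a⁻¹` of the alphabet. -/
def Letter.inv {α : Type*} (x : Letter α) : Letter α := (x.1, !x.2)

/-- `v` is a factor of the cyclic word `[w]`: a subword of some cyclic permutation of `w`. -/
def IsCyclicFactor {α : Type*} (v w : List (Letter α)) : Prop :=
  ∃ w', w' ~r w ∧ v <:+: w'

/-- The cyclic word `[w]` over the alphabet `{a₀^±1, a₁^±1, …}` is an orientable Wicks form. -/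
structure IsWicksForm (w : List (Letter ℕ)) : Prop where
  count_inv : ∀ x ∈ w, w.count x.inv = 1
  cyclicallyReduced : FreeGroup.IsCyclicallyReduced w
  factor : ∀ x y : Letter ℕ, IsCyclicFactor [x, y] w → ¬ IsCyclicFactor [y.inv, x.inv] w

/-- The polygon of `w` has corners `0, …, n - 1` (`n` the length of `w`), and its side `i`, labelled
by the `i`-th letter, runs from corner `i` to corner `i + 1` modulo `n`.  When sides `i` and `p`
carry mutually inverse labels they are identified with opposite directions, so that the initial
corner of side `i` is glued to the terminal corner of side `p`. -/
def Glued (w : List (Letter ℕ)) (i j : Fin w.length) : Prop :=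
  ∃ p : Fin w.length, w.get p = (w.get i).inv ∧ j = finRotate w.length p

/-- Number of vertices on the surface obtained from the polygon of `w`: the number of classes of
corners under the equivalence relation generated by the gluing. -/
noncomputable def numVertices (w : List (Letter ℕ)) : ℕ := Nat.card (Quot (Glued w))

/-- The (topological) genus of a Wicks form `w` is `g`: the surface obtained by gluing the sides of
the polygon has one face, `e` edges (where `2e` is the length of `w`), and Euler characteristic
`v - e + 1 = 2 - 2g`. -/
def FormHasGenus (w : List (Letter ℕ)) (g : ℕ) : Prop :=
  ∃ e : ℕ, w.length = 2 * e ∧ (numVertices w : ℤ) - e + 1 = 2 - 2 * g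

/-- A maximal orientable Wicks form of genus `g`: one of length `6(2g - 1)`. -/
def IsMaximalWicksForm (g : ℕ) (u : List (Letter ℕ)) : Prop :=
  IsWicksForm u ∧ FormHasGenus u g ∧ (u.length : ℤ) = 6 * (2 * g - 1)

/-- The cyclic words `[u]` and `[v]` are isomorphic: some bijection of the alphabet commuting with
inversion carries `[u]` to `[v]`. -/
def Iso (u v : List (Letter ℕ)) : Prop :=
  ∃ f : Equiv.Perm (Letter ℕ), (∀ x, f x.inv = (f x).inv) ∧ u.map f ~r v

theorem iso_equivalence : Equivalence Iso where
  refl u := ⟨Equiv.refl _, fun _ => rfl, by simpa using List.IsRotated.refl u⟩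
  symm := by
    rintro u v ⟨f, hf, h⟩
    refine ⟨f.symm, fun x => ?_, ?_⟩
    · rw [Equiv.symm_apply_eq, hf, Equiv.apply_symm_apply]
    · simpa using (h.map f.symm).symm
  trans := by
    rintro u v w ⟨f, hf, h⟩ ⟨f', hf', h'⟩
    refine ⟨f.trans f', fun x => by simp [hf, hf'], ?_⟩
    simpa using (h.map f').trans h'

/-- Words up to isomorphism of the cyclic words that they define. -/
def isoSetoid : Setoid (List (Letter ℕ)) := ⟨Iso, iso_equivalence⟩

/-- The map on words induced by a substitution `Φ`, where `Φ (a⁻¹) = (Φ a)⁻¹`. -/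
def subst {β : Type*} (Φ : ℕ → List (Letter β)) (u : List (Letter ℕ)) : List (Letter β) :=
  u.flatMap fun x => if x.2 then Φ x.1 else FreeGroup.invRev (Φ x.1)

/-- `(Φ, u)` is a representation of `w`: each `Φ a` is freely reduced, and `w` is the word obtained
from `Φ(u)` by free reduction. -/
def IsRepresentation {β : Type*} [DecidableEq β] (Φ : ℕ → List (Letter β)) (u : List (Letter ℕ))
    (w : List (Letter β)) : Prop :=
  (∀ i, FreeGroup.IsReduced (Φ i)) ∧ FreeGroup.reduce (subst Φ u) = w

/-- `(Φ, u)` is a genus `g` Wicks representation of `w`. -/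
def IsWicksRepresentation {β : Type*} [DecidableEq β] (g : ℕ) (Φ : ℕ → List (Letter β))
    (u : List (Letter ℕ)) (w : List (Letter β)) : Prop :=
  IsWicksForm u ∧ FormHasGenus u g ∧ ∃ u', u' ~r u ∧ IsRepresentation Φ u' w

/-- `(Φ, u)` is a non-cancelling genus `g` Wicks representation of `w`. -/
def IsNonCancellingWicksRepresentation {β : Type*} [DecidableEq β] (g : ℕ)
    (Φ : ℕ → List (Letter β)) (u : List (Letter ℕ)) (w : List (Letter β)) : Prop :=
  IsWicksRepresentation g Φ u w ∧ FreeGroup.IsCyclicallyReduced (subst Φ u)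

/-- `M(g, w)`: the number of isomorphism classes of maximal Wicks forms of genus `g` containing some
`u` for which there is a non-cancelling Wicks representation `(Φ, u)` of `w`. -/
noncomputable def M {β : Type*} [DecidableEq β] (g : ℕ) (w : List (Letter β)) : ℕ∞ :=
  Set.encard {I : Quotient isoSetoid | ∃ u, Quotient.mk isoSetoid u = I ∧ IsMaximalWicksForm g u ∧
    ∃ Φ, IsNonCancellingWicksRepresentation g Φ u w}

/-- The word `w` has genus `g`: it has a non-cancelling Wicks representation of genus `g`, and no
Wicks representation, cancelling or not, of smaller genus. -/
def HasGenus {β : Type*} [DecidableEq β] (w : List (Letter β)) (g : ℕ) : Prop :=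
  (∃ Φ u, IsNonCancellingWicksRepresentation g Φ u w) ∧
    ∀ k < g, ¬ ∃ Φ u, IsWicksRepresentation k Φ u w

/-- A word with no subword of the form `uu`, `u` nontrivial. -/
def IsSquareFree {β : Type*} (w : List β) : Prop :=
  ∀ u : List β, u ≠ [] → ¬ (u ++ u) <:+: w

end Wicks

/-! Lower bound on the genus. If a relation `R` never holds for both a turn `xy` and its inverse,
then `turnCount R`, the signed number of `R`-turns of a reduced word, is odd under inversion and is
a quasimorphism of defect 3 on the free group (`turnCount_mul_le`). In a genus `k` representation
the labels can be changed by elements at the vertices so that those along a spanning tree become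
trivial (`exists_gauge`). Then `w` is a product of `2e - 2(v - 1) = 4k` elements and trivial ones.
The sides cancel in inverse pairs in the sum of the counts, so only the defects remain, and the
count of `w` is at most `3(4k - 1)`. A word of length `12g - 6` all of whose turns lie in `R` has
count `12g - 7`, which forces `k ≥ g`.

Many forms. A planar caterpillar tree carries `g = m + 2` handles at its ends, and the edges of the
handles are joined according to two commuting permutations `P`, `R`. Geometrically the handles form
a cover of degree `g` of a one-holed torus, whose boundary lifts because the commutator of `P` and
`R` is trivial. Each such pair gives a maximal Wicks form (`isMaximalWicksForm_formWord`). The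
labelling forgets the index of every edge off the spine, and the permutations affect only such
indices, so all these forms represent one word, `surfaceWord`. A form together with a starting point
determines `P` and `R`, even up to renaming of letters. Hence an isomorphism class contains the
forms of at most `12g - 6` pairs, while the number of commuting pairs is `g!` times the number of
conjugacy classes of the symmetric group. That number is at least quadratic in `g`.

Square freeness. The spine is labelled by a square free sequence. A square avoiding spine letters is
impossible because kinds do not repeat between consecutive spine letters. Any other square survives
deletion of the remaining letters, which leaves a rotation of a square free positive word followed
by its inverse. -/

namespace Wicks

/-! ### Signed counting of turns as a quasimorphism on the free group. -/

section Turns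

variable {β : Type*}

@[simp] theorem Letter.inv_inv (x : Letter β) : x.inv.inv = x := by simp [Letter.inv]

theorem Letter.inv_ne (x : Letter β) : x.inv ≠ x := by
  intro h
  simpa [Letter.inv] using congrArg Prod.snd h

theorem invRev_cons (x : Letter β) (l : List (Letter β)) :
    FreeGroup.invRev (x :: l) = FreeGroup.invRev l ++ [x.inv] := by
  simp [FreeGroup.invRev, Letter.inv]

theorem invRev_concat (x : Letter β) (l : List (Letter β)) :
    FreeGroup.invRev (l ++ [x]) = x.inv :: FreeGroup.invRev l := by
  simp [FreeGroup.invRev, Letter.inv]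

open Classical in
/-- The value of the turn `xy`: `1` if it is related by `R`, `-1` if its inverse is. -/
noncomputable def turn (R : Letter β → Letter β → Prop) (x y : Letter β) : ℤ :=
  (if R x y then 1 else 0) - (if R y.inv x.inv then 1 else 0)

/-- The sum of the values of all turns of a word. -/
noncomputable def turnCount (R : Letter β → Letter β → Prop) : List (Letter β) → ℤ
  | [] => 0
  | [_] => 0
  | x :: y :: l => turn R x y + turnCount R (y :: l)

variable (R : Letter β → Letter β → Prop)

theorem turn_inv (x y : Letter β) : turn R y.inv x.inv = - turn R x y := by
  rw [turn, turn, Letter.inv_inv, Letter.inv_inv, neg_sub]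

theorem abs_turn_le (x y : Letter β) : |turn R x y| ≤ 1 := by
  unfold turn
  split_ifs <;> simp

theorem turnCount_append_pair (l : List (Letter β)) (x y : Letter β) :
    turnCount R (l ++ [x, y]) = turnCount R (l ++ [x]) + turn R x y := by
  induction l with
  | nil => simp [turnCount]
  | cons a l ih =>
    cases l with
    | nil => simp [turnCount]
    | cons b l =>
      simp only [List.cons_append, turnCount] at ih ⊢
      rw [ih]; ring

theorem abs_turnCount_append_le (a b : List (Letter β)) :
    |turnCount R (a ++ b) - turnCount R a - turnCount R b| ≤ 1 := by
  induction a with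
  | nil => simp [turnCount]
  | cons x a ih =>
    cases a with
    | nil =>
      cases b with
      | nil => simp [turnCount]
      | cons y b => simpa [turnCount] using abs_turn_le R x y
    | cons y a =>
      simp only [List.cons_append, turnCount] at ih ⊢
      convert ih using 2
      ring

theorem turnCount_invRev (l : List (Letter β)) :
    turnCount R (FreeGroup.invRev l) = - turnCount R l := by
  induction l with
  | nil => simp [turnCount]
  | cons x l ih =>
    cases l with
    | nil => simp [turnCount, invRev_cons]
    | cons y l =>
      rw [invRev_cons, invRev_cons, List.append_assoc, List.singleton_append,
        turnCount_append_pair, ← invRev_cons, ih, turn_inv, turnCount]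
      ring

theorem turnCount_of_isChain (hR : ∀ x y, R x y → ¬ R y.inv x.inv) (x : Letter β)
    (l : List (Letter β)) (h : (x :: l).IsChain R) : turnCount R (x :: l) = l.length := by
  induction l generalizing x with
  | nil => simp [turnCount]
  | cons y l ih =>
    rw [List.isChain_cons_cons] at h
    rw [turnCount, ih y h.2]
    simp [turn, h.1, hR x y h.1]
    ring

theorem isReduced_append_cons {a b : List (Letter β)} {x y : Letter β}
    (ha : FreeGroup.IsReduced (a ++ [x])) (hb : FreeGroup.IsReduced (y :: b)) (h : y ≠ x.inv) :
    FreeGroup.IsReduced (a ++ [x] ++ y :: b) := by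
  unfold FreeGroup.IsReduced at *
  rw [List.isChain_append]
  refine ⟨ha, hb, ?_⟩
  simp only [List.getLast?_append, List.getLast?_singleton, List.head?_cons, Option.mem_def,
    Option.some.injEq, Option.some_or]
  rintro _ rfl _ rfl h1
  by_contra h2
  apply h
  ext
  · exact h1.symm
  · simp only [Letter.inv]
    exact Bool.eq_not.2 (Ne.symm h2)

/-- Two reduced words are multiplied by cancelling a common middle part. -/
theorem exists_cancellation (a b : List (Letter β)) (ha : FreeGroup.IsReduced a)
    (hb : FreeGroup.IsReduced b) :
    ∃ a' c b', a = a' ++ c ∧ b = FreeGroup.invRev c ++ b' ∧ FreeGroup.IsReduced (a' ++ b') := by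
  induction a using List.reverseRecOn generalizing b with
  | nil => exact ⟨[], [], b, by simp, by simp, by simpa using hb⟩
  | append_singleton a x ih =>
    cases b with
    | nil => exact ⟨a ++ [x], [], [], by simp, by simp, by simpa using ha⟩
    | cons y b =>
      by_cases h : y = x.inv
      · obtain ⟨a', c, b', rfl, rfl, hr⟩ := ih b (ha.infix ⟨[], [x], by simp⟩)
          (hb.infix ⟨[y], [], by simp⟩)
        exact ⟨a', c ++ [x], b', by simp,
          by rw [invRev_concat, h, List.cons_append], hr⟩
      · exact ⟨a ++ [x], [], y :: b, by simp, by simp, isReduced_append_cons ha hb h⟩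

variable [DecidableEq β]

/-- The cancelled part contributes opposite amounts to the two factors. What remains are three
junction turns, one in each factor and one in the product, each of absolute value at most 1. -/
theorem turnCount_mul_le (g h : FreeGroup β) :
    turnCount R (g * h).toWord ≤ turnCount R g.toWord + turnCount R h.toWord + 3 := by
  obtain ⟨a, c, b, hg, hh, hr⟩ := exists_cancellation g.toWord h.toWord
    FreeGroup.isReduced_toWord FreeGroup.isReduced_toWord
  have hgh : (g * h).toWord = a ++ b := by
    rw [← hr.reduce_eq, ← FreeGroup.toWord_mk]
    congr 1
    rw [← FreeGroup.mk_toWord (x := g), ← FreeGroup.mk_toWord (x := h), hg, hh,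
      ← FreeGroup.mul_mk, ← FreeGroup.mul_mk, ← FreeGroup.mul_mk, ← FreeGroup.inv_mk]
    group
  have h1 := abs_le.1 (abs_turnCount_append_le R a c)
  have h2 := abs_le.1 (abs_turnCount_append_le R (FreeGroup.invRev c) b)
  have h3 := abs_le.1 (abs_turnCount_append_le R a b)
  rw [turnCount_invRev] at h2
  rw [hgh, hg, hh]
  linarith [h1.1, h2.1, h3.2]

theorem turnCount_inv (g : FreeGroup β) :
    turnCount R g⁻¹.toWord = - turnCount R g.toWord := by
  rw [FreeGroup.toWord_inv, turnCount_invRev]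

theorem turnCount_mul_prod_le (x : FreeGroup β) (l : List (FreeGroup β)) :
    turnCount R (x * l.prod).toWord ≤ turnCount R x.toWord +
      (l.map fun g => turnCount R g.toWord).sum + 3 * (l.countP (fun g => decide (g ≠ 1)) : ℤ) := by
  induction l generalizing x with
  | nil => simp
  | cons g l ih =>
    by_cases hg : g = 1
    · subst hg
      simpa [turnCount] using ih x
    · have h1 := ih (x * g)
      have h2 := turnCount_mul_le R x g
      rw [List.prod_cons, ← mul_assoc, List.countP_cons_of_pos (by simpa using hg)]
      simp only [List.map_cons, List.sum_cons]
      push_cast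
      linarith

/-- Trivial factors cost nothing, and `n` nontrivial ones require only `n - 1` multiplications.
Nontriviality of the product ensures `n ≥ 1`. -/
theorem turnCount_prod_le (l : List (FreeGroup β)) (h : l.prod ≠ 1) :
    turnCount R l.prod.toWord ≤ (l.map fun g => turnCount R g.toWord).sum +
      3 * (l.countP (fun g => decide (g ≠ 1)) : ℤ) - 3 := by
  induction l with
  | nil => simp at h
  | cons g l ih =>
    by_cases hg : g = 1
    · subst hg
      simp only [List.prod_cons, one_mul] at h ⊢
      simpa [turnCount] using ih h
    · have h1 := turnCount_mul_prod_le R g l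
      rw [List.prod_cons, List.countP_cons_of_pos (by simpa using hg)]
      simp only [List.map_cons, List.sum_cons]
      push_cast
      linarith

end Turns

/-! ### Trivializing the edge labels along a spanning tree. -/

section Gauge

theorem finRotate_induction {n : ℕ} {p : Fin n → Prop} (i₀ : Fin n) (h₀ : p i₀)
    (h : ∀ i, p i → p (finRotate n i)) (j : Fin n) : p j := by
  cases n with
  | zero => exact i₀.elim0
  | succ n =>
    have key : ∀ d : Fin (n + 1), p (i₀ + d) := by
      intro d
      induction d using Fin.induction with
      | zero => simpa using h₀
      | succ d ih =>
        have := h _ ih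
        rwa [finRotate_apply, add_assoc, Fin.coeSucc_eq_succ] at this
    simpa using key (j - i₀)

theorem finRotate_mk_of_lt {n k : ℕ} (h : k + 1 < n) :
    finRotate n ⟨k, by omega⟩ = ⟨k + 1, h⟩ := by
  cases n with
  | zero => omega
  | succ n => exact finRotate_of_lt (by omega)

theorem finRotate_mk_last {n k : ℕ} (h : k + 1 = n) :
    finRotate n ⟨k, by omega⟩ = ⟨0, by omega⟩ := by
  subst h
  exact finRotate_last'

variable {u : List (Letter ℕ)}

theorem exists_partner (hu : ∀ x ∈ u, u.count x.inv = 1) (i : Fin u.length) :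
    ∃ p, u.get p = (u.get i).inv := by
  have h := hu (u.get i) (List.get_mem u i)
  have : (u.get i).inv ∈ u := List.count_pos_iff.1 (by omega)
  obtain ⟨p, hp⟩ := List.get_of_mem this
  exact ⟨p, hp⟩

theorem mk_corner_eq {i p : Fin u.length} (h : u.get p = (u.get i).inv) :
    Quot.mk (Glued u) i = Quot.mk (Glued u) (finRotate _ p) :=
  Quot.sound ⟨p, h, rfl⟩

variable {G : Type*} [Group G]

/-- The label of a side after changing the labels of the edges by elements at the vertices. -/
def gauged (φ : Letter ℕ → G) (h : Quot (Glued u) → G) (i : Fin u.length) : G :=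
  (h (Quot.mk _ i))⁻¹ * φ (u.get i) * h (Quot.mk _ (finRotate _ i))

theorem gauged_partner {φ : Letter ℕ → G} (hφ : ∀ x, φ x.inv = (φ x)⁻¹)
    (h : Quot (Glued u) → G) {i p : Fin u.length} (hp : u.get p = (u.get i).inv) :
    gauged φ h p = (gauged φ h i)⁻¹ := by
  have hp' : u.get i = (u.get p).inv := by rw [hp, Letter.inv_inv]
  unfold gauged
  rw [mk_corner_eq hp, mk_corner_eq hp', hp, hφ]
  group

instance : Finite (Quot (Glued u)) := Finite.of_surjective _ Quot.mk_surjective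

/-- Along a spanning tree of the graph of the surface all labels can be made trivial. -/
theorem exists_gauge (hu : ∀ x ∈ u, u.count x.inv = 1) {φ : Letter ℕ → G}
    (hφ : ∀ x, φ x.inv = (φ x)⁻¹) (i₀ : Fin u.length) (m : ℕ) (hm : m + 1 ≤ numVertices u) :
    ∃ (h : Quot (Glued u) → G) (A : Finset (Quot (Glued u))) (T : Finset (Fin u.length)),
      h (Quot.mk _ i₀) = 1 ∧ Quot.mk _ i₀ ∈ A ∧ A.card = m + 1 ∧ T.card = 2 * m ∧
      ∀ i ∈ T, gauged φ h i = 1 ∧ Quot.mk _ i ∈ A ∧ Quot.mk _ (finRotate _ i) ∈ A := by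
  classical
  induction m with
  | zero => exact ⟨1, {Quot.mk _ i₀}, ∅, by simp⟩
  | succ m ih =>
    obtain ⟨h, A, T, h0, hA0, hA, hT, hAT⟩ := ih (by omega)
    -- The boundary of the polygon passes through every vertex, so while `A` is not everything some
    -- side leaves it; this replaces connectedness of the graph.
    obtain ⟨i, hi, hi'⟩ : ∃ i, Quot.mk (Glued u) i ∈ A ∧
        Quot.mk (Glued u) (finRotate _ i) ∉ A := by
      by_contra! hcon
      have hall : ∀ v, v ∈ A := fun v =>
        Quot.inductionOn v fun j => finRotate_induction i₀ hA0 hcon j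
      have : numVertices u = A.card := by
        have := Fintype.ofFinite (Quot (Glued u))
        rw [Finset.eq_univ_of_forall hall, Finset.card_univ]
        exact Nat.card_eq_fintype_card
      omega
    obtain ⟨p, hp⟩ := exists_partner hu i
    have hp' : u.get i = (u.get p).inv := by rw [hp, Letter.inv_inv]
    have hip : i ≠ p := by
      rintro rfl
      exact Letter.inv_ne _ hp.symm
    have hiT : i ∉ T := fun hh => hi' (hAT i hh).2.2
    have hpT : p ∉ T := fun hh => hi' (mk_corner_eq hp' ▸ (hAT p hh).2.1)
    set v := Quot.mk (Glued u) (finRotate _ i) with hv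
    -- The value at the new vertex is the one that trivializes side `i`. Sides already in `T` have
    -- both ends in `A`, where nothing changes.
    set h' := Function.update h v ((φ (u.get i))⁻¹ * h (Quot.mk _ i)) with hh'
    have hne : ∀ a ∈ A, h' a = h a := by
      intro a ha
      exact Function.update_of_ne (by rintro rfl; exact hi' ha) _ _
    have hgi : gauged φ h' i = 1 := by
      unfold gauged
      rw [hne _ hi, ← hv, hh', Function.update_self]
      group
    refine ⟨h', insert v A, insert i (insert p T), ?_, ?_, ?_, ?_, ?_⟩
    · rw [hne _ hA0, h0]
    · exact Finset.mem_insert_of_mem hA0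
    · rw [Finset.card_insert_of_notMem hi', hA]
    · rw [Finset.card_insert_of_notMem (by simp [hip, hiT]), Finset.card_insert_of_notMem hpT, hT]
      ring
    · intro j hj
      rw [Finset.mem_insert, Finset.mem_insert] at hj
      rcases hj with rfl | rfl | hj
      · exact ⟨hgi, Finset.mem_insert_of_mem hi, Finset.mem_insert_self _ _⟩
      · refine ⟨by rw [gauged_partner hφ h' hp, hgi, inv_one], ?_, ?_⟩
        · rw [mk_corner_eq hp']
          exact Finset.mem_insert_self _ _
        · rw [← mk_corner_eq hp]
          exact Finset.mem_insert_of_mem hi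
      · obtain ⟨h1, h2, h3⟩ := hAT j hj
        refine ⟨?_, Finset.mem_insert_of_mem h2, Finset.mem_insert_of_mem h3⟩
        rw [← h1]
        unfold gauged
        rw [hne _ h2, hne _ h3]

/-- The product telescopes: the elements at each intermediate corner cancel. -/
theorem prod_gauged_take (φ : Letter ℕ → G) (h : Quot (Glued u) → G) (hu : 0 < u.length)
    (k : ℕ) (hk : k < u.length) :
    ((List.ofFn (gauged φ h)).take k).prod =
      (h (Quot.mk _ ⟨0, hu⟩))⁻¹ * ((u.map φ).take k).prod * h (Quot.mk _ ⟨k, hk⟩) := by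
  induction k with
  | zero => simp
  | succ k ih =>
    have hk' : k < u.length := by omega
    rw [List.prod_take_succ _ _ (by simpa using hk'), List.prod_take_succ _ _ (by simpa using hk'),
      ih hk']
    have : finRotate u.length ⟨k, hk'⟩ = ⟨k + 1, hk⟩ := finRotate_mk_of_lt hk
    simp only [List.getElem_ofFn, gauged, this, List.getElem_map, List.get_eq_getElem]
    group

theorem prod_gauged (φ : Letter ℕ → G) (h : Quot (Glued u) → G) (hu : 0 < u.length) :
    (List.ofFn (gauged φ h)).prod =
      (h (Quot.mk _ ⟨0, hu⟩))⁻¹ * (u.map φ).prod * h (Quot.mk _ ⟨0, hu⟩) := by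
  obtain ⟨n, hn⟩ : ∃ n, u.length = n + 1 := ⟨u.length - 1, by omega⟩
  have hlt : n < u.length := by omega
  have h1 := prod_gauged_take φ h hu n hlt
  have h2 : (List.ofFn (gauged φ h)).take (n + 1) = List.ofFn (gauged φ h) :=
    List.take_of_length_le (by simp [hn])
  have h3 : (u.map φ).take (n + 1) = u.map φ := List.take_of_length_le (by simp [hn])
  rw [← h2, ← h3, List.prod_take_succ _ _ (by simpa using hlt),
    List.prod_take_succ _ _ (by simpa using hlt), h1]
  have : finRotate u.length ⟨n, hlt⟩ = ⟨0, hu⟩ := finRotate_mk_last hn.symm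
  simp only [List.getElem_ofFn, gauged, this, List.getElem_map, List.get_eq_getElem]
  group

end Gauge

/-! ### The bound on the turn count of a word represented in genus `k`. -/

section LowerBound

variable {β : Type*}

/-- The value in the free group of a letter under a substitution. -/
def letterValue (Φ : ℕ → List (Letter β)) (x : Letter ℕ) : FreeGroup β :=
  if x.2 then FreeGroup.mk (Φ x.1) else (FreeGroup.mk (Φ x.1))⁻¹

theorem letterValue_inv (Φ : ℕ → List (Letter β)) (x : Letter ℕ) :
    letterValue Φ x.inv = (letterValue Φ x)⁻¹ := by
  rcases x with ⟨a, _ | _⟩ <;> simp [letterValue, Letter.inv]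

theorem mk_subst (Φ : ℕ → List (Letter β)) (u : List (Letter ℕ)) :
    FreeGroup.mk (subst Φ u) = (u.map (letterValue Φ)).prod := by
  induction u with
  | nil => rfl
  | cons x u ih =>
    rw [List.map_cons, List.prod_cons, ← ih]
    rcases x with ⟨a, _ | _⟩ <;> simp [letterValue, subst]

variable [DecidableEq β]

/-- Passing to the partner side is an involution of the sides that inverts the label, hence reverses
the sign of the turn count. -/
theorem sum_turnCount_gauged (R : Letter β → Letter β → Prop) {u : List (Letter ℕ)}
    (hu : ∀ x ∈ u, u.count x.inv = 1) {φ : Letter ℕ → FreeGroup β}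
    (hφ : ∀ x, φ x.inv = (φ x)⁻¹) (h : Quot (Glued u) → FreeGroup β) :
    ∑ i, turnCount R (gauged φ h i).toWord = 0 := by
  choose τ hτ using exists_partner hu
  have hnodup : u.Nodup := by
    rw [List.nodup_iff_count_le_one]
    intro x
    by_cases hx : x ∈ u
    · have h1 := hu x hx
      have h2 := hu x.inv (List.count_pos_iff.1 (by omega))
      rw [Letter.inv_inv] at h2
      omega
    · rw [List.count_eq_zero_of_not_mem hx]; omega
  have hinj := List.nodup_iff_injective_get.1 hnodup
  have hττ : Function.Involutive τ := fun i => hinj (by rw [hτ, hτ, Letter.inv_inv])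
  have h1 : ∑ i, turnCount R (gauged φ h (τ i)).toWord =
      ∑ i, turnCount R (gauged φ h i).toWord :=
    Equiv.sum_comp hττ.toPerm fun i => turnCount R (gauged φ h i).toWord
  have h2 : ∑ i, turnCount R (gauged φ h (τ i)).toWord =
      - ∑ i, turnCount R (gauged φ h i).toWord := by
    rw [← Finset.sum_neg_distrib]
    refine Finset.sum_congr rfl fun i _ => ?_
    rw [gauged_partner hφ h (hτ i), turnCount_inv]
  linarith

/-- The tree accounts for `2(v - 1)` trivial sides out of `2e`, leaving at most `4k` nontrivial
factors. The elements at the vertices are normalized to 1 at the base corner, so the product is the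
word itself and not merely a conjugate. -/
theorem turnCount_le_of_formHasGenus (R : Letter β → Letter β → Prop) {u : List (Letter ℕ)}
    {k : ℕ} (hu : ∀ x ∈ u, u.count x.inv = 1) (hk : FormHasGenus u k)
    (Φ : ℕ → List (Letter β)) (hw : FreeGroup.reduce (subst Φ u) ≠ []) :
    turnCount R (FreeGroup.reduce (subst Φ u)) ≤ 12 * k - 3 := by
  classical
  obtain ⟨e, he, hv⟩ := hk
  have hpos : 0 < u.length := by
    by_contra hcon
    have hnil : u = [] := List.length_eq_zero_iff.1 (by omega)
    subst hnil
    simp [subst] at hw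
  have hvpos : 0 < numVertices u := by
    unfold numVertices
    have : Nonempty (Quot (Glued u)) := ⟨Quot.mk _ ⟨0, hpos⟩⟩
    exact Nat.card_pos
  have hφ := letterValue_inv Φ
  obtain ⟨h, A, T, h0, -, -, hT, hAT⟩ :=
    exists_gauge hu hφ ⟨0, hpos⟩ (numVertices u - 1) (by omega)
  have hprod := prod_gauged (letterValue Φ) h hpos
  rw [h0, inv_one, one_mul, mul_one, ← mk_subst] at hprod
  rw [← FreeGroup.toWord_mk] at hw ⊢
  have hne : (List.ofFn (gauged (letterValue Φ) h)).prod ≠ 1 := by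
    rw [hprod]
    intro h1
    rw [h1] at hw
    simp at hw
  have hle := turnCount_prod_le R _ hne
  rw [hprod, List.map_ofFn, List.sum_ofFn] at hle
  have hsum := sum_turnCount_gauged R hu hφ h
  have hcount : (List.ofFn (gauged (letterValue Φ) h)).countP (fun g => decide (g ≠ 1)) + T.card ≤
      u.length := by
    rw [List.ofFn_eq_map, List.countP_map, List.countP_eq_length_filter]
    have h1 : ((List.finRange u.length).filter
        ((fun g => decide (g ≠ 1)) ∘ gauged (letterValue Φ) h)).toFinset ⊆ Tᶜ := by
      intro i hi
      simp only [List.mem_toFinset, List.mem_filter, Function.comp, decide_eq_true_eq] at hi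
      exact Finset.mem_compl.2 fun hiT => hi.2 (hAT i hiT).1
    have h2 := Finset.card_le_card h1
    rw [List.toFinset_card_of_nodup ((List.nodup_finRange _).filter _), Finset.card_compl,
      Fintype.card_fin] at h2
    have h3 : T.card ≤ u.length := by simpa using Finset.card_le_univ T
    omega
  simp only [Function.comp_def] at hle
  rw [hsum] at hle
  have : (numVertices u : ℤ) - 1 = ((numVertices u - 1 : ℕ) : ℤ) := by omega
  zify at hcount hT he
  linarith

end LowerBound

/-! ### Invariance of the genus of a form under rotation. -/

section Rotation

theorem numVertices_congr {u v : List (Letter ℕ)} (e : Fin v.length ≃ Fin u.length)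
    (hget : ∀ i, v.get i = u.get (e i)) (hrot : ∀ i, e (finRotate _ i) = finRotate _ (e i)) :
    numVertices v = numVertices u := by
  refine Nat.card_congr (Quot.congr e fun i j => ⟨?_, ?_⟩)
  · rintro ⟨p, hp, rfl⟩
    exact ⟨e p, by rw [← hget, ← hget, hp], hrot p⟩
  · rintro ⟨q, hq, hj⟩
    refine ⟨e.symm q, ?_, e.injective ?_⟩
    · rw [hget, hget, e.apply_symm_apply, hq]
    · rw [hj, hrot, e.apply_symm_apply]

theorem val_finRotate_pow {n : ℕ} (k : ℕ) (i : Fin n) :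
    ((finRotate n ^ k) i : ℕ) = (i + k) % n := by
  induction k with
  | zero => simp [Nat.mod_eq_of_lt i.2]
  | succ k ih =>
    rw [pow_succ', Equiv.Perm.mul_apply]
    have hn : (i + k) % n < n := Nat.mod_lt _ (by have := i.2; omega)
    have hi : (finRotate n ^ k) i = ⟨(i + k) % n, hn⟩ := Fin.ext ih
    rw [hi]
    rcases Nat.lt_or_ge ((i + k) % n + 1) n with h | h
    · rw [finRotate_mk_of_lt h, ← Nat.add_assoc, Nat.add_mod _ 1 n,
        Nat.mod_eq_of_lt (show 1 < n by omega), Nat.mod_eq_of_lt h]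
    · have h' : (i + k) % n + 1 = n := by omega
      have h0 : (i + (k + 1)) % n = 0 := by
        rw [← Nat.add_assoc, ← Nat.mod_add_mod, h', Nat.mod_self]
      rw [finRotate_mk_last h', h0]

theorem finRotate_finCongr {m n : ℕ} (h : m = n) (i : Fin m) :
    finCongr h (finRotate m i) = finRotate n (finCongr h i) := by
  subst h
  rfl

theorem numVertices_rotate (u : List (Letter ℕ)) (k : ℕ) :
    numVertices (u.rotate k) = numVertices u := by
  refine numVertices_congr ((finCongr (List.length_rotate u k)).trans (finRotate _ ^ k)) ?_ ?_
  · intro i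
    simp only [List.get_eq_getElem, List.getElem_rotate, Equiv.trans_apply, val_finRotate_pow]
    rfl
  · intro i
    simp only [Equiv.trans_apply, finRotate_finCongr]
    rw [← Equiv.Perm.mul_apply, ← Equiv.Perm.mul_apply, ← pow_succ, ← pow_succ']

theorem FormHasGenus.of_isRotated {u v : List (Letter ℕ)} {g : ℕ} (h : FormHasGenus u g)
    (huv : v ~r u) : FormHasGenus v g := by
  obtain ⟨k, rfl⟩ := huv.symm
  unfold FormHasGenus at *
  rwa [numVertices_rotate, List.length_rotate]

end Rotation

/-! ### Words with only positive turns have large genus. -/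

section Genus

variable {β : Type*}

theorem isReduced_of_isChain {R : Letter β → Letter β → Prop}
    (hR : ∀ x y, R x y → ¬ R y.inv x.inv) {w : List (Letter β)} (hw : w.IsChain R) :
    FreeGroup.IsReduced w := by
  refine List.IsChain.imp (fun x y hxy h1 => ?_) hw
  by_contra h2
  have h : y = Letter.inv x := Prod.ext h1.symm (Bool.eq_not.2 (Ne.symm h2))
  subst h
  exact hR _ _ hxy (by simpa only [Letter.inv_inv] using hxy)

variable [DecidableEq β]

/-- A word all of whose turns are positive for `R` has genus at least `g` if its length is
`6 (2g - 1)`. -/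
theorem not_isWicksRepresentation_of_isChain {R : Letter β → Letter β → Prop}
    (hR : ∀ x y, R x y → ¬ R y.inv x.inv) {w : List (Letter β)} (hw : w.IsChain R) {g k : ℕ}
    (hlen : w.length + 6 = 12 * g) (hk : k < g) :
    ¬ ∃ Φ u, IsWicksRepresentation k Φ u w := by
  rintro ⟨Φ, u, hu, hug, u', hu', -, hΦ⟩
  have hinv : ∀ x ∈ u', u'.count x.inv = 1 := fun x hx => by
    rw [hu'.perm.count_eq]
    exact hu.count_inv x (hu'.perm.mem_iff.1 hx)
  cases w with
  | nil => simp at hlen; omega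
  | cons x l =>
    -- The inequality becomes `12g - 7 ≤ 12k - 3`, impossible for `k ≤ g - 1`.
    have h := turnCount_le_of_formHasGenus R hinv (hug.of_isRotated hu') Φ (by simp [hΦ])
    rw [hΦ, turnCount_of_isChain R hR x l hw] at h
    simp only [List.length_cons] at hlen
    omega

end Genus

/-! ### Square free words: existence, and rotations of two-block words. -/

section SquareFree

variable {α β : Type*}

theorem IsSquareFree.infix {v w : List α} (hw : IsSquareFree w) (h : v <:+: w) :
    IsSquareFree v := fun u hu huv => hw u hu (huv.trans h)

theorem IsSquareFree.reverse {w : List α} (hw : IsSquareFree w) : IsSquareFree w.reverse := by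
  intro u hu h
  refine hw u.reverse (by simpa using hu) ?_
  rw [← List.reverse_append, ← List.reverse_infix, List.reverse_reverse]
  exact h

theorem IsSquareFree.map {w : List α} (hw : IsSquareFree w) {f : α → β}
    (hf : Function.Injective f) : IsSquareFree (w.map f) := by
  rintro u hu ⟨s, t, h⟩
  obtain ⟨a, t', rfl, h1, rfl⟩ := List.map_eq_append_iff.1 h.symm
  obtain ⟨s', b, rfl, rfl, h2⟩ := List.map_eq_append_iff.1 h1
  obtain ⟨c, d, rfl, rfl, h3⟩ := List.map_eq_append_iff.1 h2
  obtain rfl := List.map_injective_iff.2 hf h3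
  exact hw d (by rintro rfl; exact hu rfl) ⟨s', t', rfl⟩

/-- A square prefix of `l` determines `l` from what remains after deleting half of it. -/
theorem exists_square_prefix [DecidableEq α] {a : α} {l : List α} (hl : IsSquareFree l)
    (h : ¬ IsSquareFree (a :: l)) :
    ∃ j, 1 ≤ j ∧ j ≤ l.length ∧ a :: l = ((a :: l).drop j).take j ++ (a :: l).drop j := by
  unfold IsSquareFree at h
  push Not at h
  obtain ⟨u, hu, huu⟩ := h
  rcases List.infix_cons_iff.1 huu with h | h
  · obtain ⟨t, ht⟩ := h
    have hpos := List.length_pos_iff.2 hu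
    have hlen := congrArg List.length ht
    simp only [List.length_append, List.length_cons] at hlen
    refine ⟨u.length, hpos, by omega, ?_⟩
    rw [← ht]
    simp
  · exact absurd h (hl u hu)

variable (α) in
open Classical in
/-- The square free words of length `n`. -/
noncomputable def squareFreeWords [Fintype α] : ℕ → Finset (List α)
  | 0 => {[]}
  | n + 1 => ((Finset.univ ×ˢ squareFreeWords n).image fun p : α × List α => p.1 :: p.2).filter
      IsSquareFree

theorem mem_squareFreeWords [Fintype α] {n : ℕ} {w : List α} :
    w ∈ squareFreeWords α n ↔ w.length = n ∧ IsSquareFree w := by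
  induction n generalizing w with
  | zero =>
    simp only [squareFreeWords, Finset.mem_singleton, List.length_eq_zero_iff]
    refine ⟨?_, fun h => h.1⟩
    rintro rfl
    exact ⟨rfl, fun u hu h => hu (by simpa using h)⟩
  | succ n ih =>
    simp only [squareFreeWords, Finset.mem_filter, Finset.mem_image, Finset.mem_product,
      Finset.mem_univ, true_and, Prod.exists]
    constructor
    · rintro ⟨⟨a, l, hl, rfl⟩, h⟩
      exact ⟨by simp [(ih.1 hl).1], h⟩
    · rintro ⟨h1, h2⟩
      cases w with
      | nil => simp at h1
      | cons a l =>
        exact ⟨⟨a, l, ih.2 ⟨by simpa using h1, h2.infix (List.suffix_cons a l).isInfix⟩, rfl⟩, h2⟩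

/-- Over at least four letters the number of square free words doubles with each letter. -/
theorem two_mul_card_squareFreeWords_le [Fintype α] (hα : 4 ≤ Fintype.card α) (n : ℕ) :
    2 * (squareFreeWords α n).card ≤ (squareFreeWords α (n + 1)).card := by
  classical
  induction n using Nat.strong_induction_on with
  | _ n ih =>
  -- By the doubling at smaller lengths the sum is dominated by a geometric series: two copies of
  -- the last term pay for that term and for two copies of the next one.
  have hsum : ∀ m ≤ n, ∑ k ∈ Finset.range m, (squareFreeWords α (n - k)).card +
      2 * (squareFreeWords α (n - m)).card ≤ 2 * (squareFreeWords α n).card := by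
    intro m hm
    induction m with
    | zero => simp
    | succ m ihm =>
      have h1 := ih (n - (m + 1)) (by omega)
      rw [show n - (m + 1) + 1 = n - m by omega] at h1
      have h2 := ihm (by omega)
      rw [Finset.sum_range_succ]
      omega
  -- A one-letter extension that is not square free begins with a square, so it is recovered from a
  -- square free word of length `n - k` by repeating its first `k + 1` letters.
  have hcover : (Finset.univ ×ˢ squareFreeWords α n).image (fun p : α × List α => p.1 :: p.2) ⊆
      squareFreeWords α (n + 1) ∪ (Finset.range n).biUnion fun k =>
        (squareFreeWords α (n - k)).image fun l => l.take (k + 1) ++ l := by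
    intro w hw
    simp only [Finset.mem_image, Finset.mem_product, Finset.mem_univ, true_and, Prod.exists] at hw
    obtain ⟨a, l, hl, rfl⟩ := hw
    obtain ⟨hlen, hsq⟩ := mem_squareFreeWords.1 hl
    by_cases h : IsSquareFree (a :: l)
    · exact Finset.mem_union_left _ (mem_squareFreeWords.2 ⟨by simp [hlen], h⟩)
    · obtain ⟨j, hj1, hj2, hj⟩ := exists_square_prefix hsq h
      obtain ⟨k, rfl⟩ : ∃ k, j = k + 1 := ⟨j - 1, by omega⟩
      refine Finset.mem_union_right _ (Finset.mem_biUnion.2 ⟨k, Finset.mem_range.2 (by omega),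
        Finset.mem_image.2 ⟨(a :: l).drop (k + 1), mem_squareFreeWords.2 ⟨?_, ?_⟩, hj.symm⟩⟩)
      · simp [hlen]
      · rw [List.drop_succ_cons]
        exact hsq.infix (List.drop_suffix _ _).isInfix
  have hcard := (Finset.card_le_card hcover).trans (Finset.card_union_le _ _)
  rw [Finset.card_image_of_injective _ (fun p q h => by
    simp only [List.cons.injEq] at h; exact Prod.ext h.1 h.2), Finset.card_product,
    Finset.card_univ] at hcard
  have hbad : ((Finset.range n).biUnion fun k =>
      (squareFreeWords α (n - k)).image fun l => l.take (k + 1) ++ l).card ≤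
      2 * (squareFreeWords α n).card := by
    refine Finset.card_biUnion_le.trans (le_trans (Finset.sum_le_sum fun k _ =>
      Finset.card_image_le) ?_)
    have := hsum n le_rfl
    omega
  have := Nat.mul_le_mul_right (squareFreeWords α n).card hα
  omega

variable (α) in
theorem exists_isSquareFree [Fintype α] (hα : 4 ≤ Fintype.card α) (n : ℕ) :
    ∃ w : List α, w.length = n ∧ IsSquareFree w := by
  have h : 0 < (squareFreeWords α n).card := by
    induction n with
    | zero => simp [squareFreeWords]
    | succ n ih =>
      have := two_mul_card_squareFreeWords_le hα n
      omega
  obtain ⟨w, hw⟩ := Finset.card_pos.1 h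
  exact ⟨w, mem_squareFreeWords.1 hw⟩

/-- A rotation of `a ++ b`, where all letters of `a` and none of `b` have the property `p`, is
square free if `a` and `b` are. -/
theorem isSquareFree_of_isRotated_append {a b w : List α} {p : α → Bool} (ha : ∀ x ∈ a, p x)
    (hb : ∀ x ∈ b, ¬ p x) (hsa : IsSquareFree a) (hsb : IsSquareFree b) (ha0 : a ≠ [])
    (hb0 : b ≠ []) (hw : w ~r a ++ b) : IsSquareFree w := by
  -- A rotation splits one of the two blocks into the outer pieces `x` and `z`, with the other block
  -- `y` intact between them.
  have key : ∀ (q : α → Bool) (x y z : List α), (∀ c ∈ x, q c) → (∀ c ∈ z, q c) →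
      (∀ c ∈ y, ¬ q c) → IsSquareFree x → IsSquareFree y → IsSquareFree z → y ≠ [] →
      IsSquareFree (x ++ y ++ z) := by
    intro q x y z hx hz hy hsx hsy hsz hy0 u hu ⟨s, t, hst⟩
    have hlen := congrArg List.length hst
    simp only [List.length_append] at hlen
    have hupos := List.length_pos_iff.2 hu
    have hypos := List.length_pos_iff.2 hy0
    have hq : ∀ i (hi : i < (x ++ y ++ z).length),
        q (x ++ y ++ z)[i] = true ↔ (i < x.length ∨ x.length + y.length ≤ i) := by
      intro i hi
      simp only [List.length_append] at hi
      rcases Nat.lt_or_ge i x.length with h1 | h1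
      · simp only [h1, true_or, iff_true]
        rw [List.getElem_append_left (by simp; omega), List.getElem_append_left h1]
        exact hx _ (List.getElem_mem _)
      · rcases Nat.lt_or_ge i (x.length + y.length) with h2 | h2
        · rw [List.getElem_append_left (by simp; omega), List.getElem_append_right h1]
          have := hy y[i - x.length] (List.getElem_mem _)
          constructor
          · intro h; exact absurd h this
          · omega
        · simp only [h2, or_true, iff_true]
          rw [List.getElem_append_right (by simp; omega)]
          exact hz _ (List.getElem_mem _)
    have hu1 : ∀ k (hk : k < u.length), u[k] = (x ++ y ++ z)[s.length + k]'(by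
        simp only [List.length_append]; omega) := by
      intro k hk
      simp only [← hst]
      rw [List.getElem_append_left (by simp; omega), List.getElem_append_right (by omega),
        List.getElem_append_left (by omega)]
      simp
    have hu2 : ∀ k (hk : k < u.length), u[k] = (x ++ y ++ z)[s.length + u.length + k]'(by
        simp only [List.length_append]; omega) := by
      intro k hk
      simp only [← hst]
      rw [List.getElem_append_left (by simp; omega), List.getElem_append_right (by omega),
        List.getElem_append_right (by omega)]
      congr 1
      omega
    have hall : ∀ k (hk : k < u.length), (q u[k] = true ↔ (s.length + k < x.length ∨
        x.length + y.length ≤ s.length + k)) ∧ (q u[k] = true ↔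
        (s.length + u.length + k < x.length ∨ x.length + y.length ≤ s.length + u.length + k)) := by
      intro k hk
      exact ⟨by rw [hu1 k hk, hq], by rw [hu2 k hk, hq]⟩
    by_cases hex : ∃ k, ∃ hk : k < u.length, ¬ q u[k]
    · obtain ⟨j, hj, hqj⟩ := hex
      have h1 := hall j hj
      have h2 := hall 0 hupos
      have h3 := hall (u.length - 1) (by omega)
      -- Both occurrences of the letter at offset `j` lie in the interval `y`, hence so does the
      -- full period between them, which contains every letter of `u`.
      have hnone : ∀ c ∈ u, ¬ q c := by
        intro c hc
        obtain ⟨k, hk, rfl⟩ := List.getElem_of_mem hc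
        have h4 := hall k hk
        intro hqk
        rw [iff_false_left hqj, iff_false_left hqj] at h1
        rw [iff_true_left hqk, iff_true_left hqk] at h4
        omega
      have hfilter := congrArg (List.filter fun c => !q c) hst
      simp only [List.filter_append] at hfilter
      have hfu : (u.filter fun c => !q c) = u :=
        List.filter_eq_self.2 fun c hc => by simpa using hnone c hc
      have hfx : (x.filter fun c => !q c) = [] :=
        List.filter_eq_nil_iff.2 fun c hc => by simpa using hx c hc
      have hfy : (y.filter fun c => !q c) = y :=
        List.filter_eq_self.2 fun c hc => by simpa using hy c hc
      have hfz : (z.filter fun c => !q c) = [] :=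
        List.filter_eq_nil_iff.2 fun c hc => by simpa using hz c hc
      rw [hfu, hfx, hfy, hfz, List.nil_append, List.append_nil] at hfilter
      exact hsy u hu ⟨_, _, hfilter⟩
    · push Not at hex
      have h1 := (hall 0 hupos).1.1 (hex 0 hupos)
      -- Here the square avoids the nonempty interval `y`, so it lies entirely in `x` or entirely in
      -- `z`.
      by_cases hpos : s.length + 2 * u.length ≤ x.length
      · have hpre : s ++ (u ++ u) <+: x := by
          refine List.prefix_of_prefix_length_le (l₃ := x ++ y ++ z) ⟨t, hst⟩ ⟨y ++ z, by simp⟩ ?_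
          simp only [List.length_append]
          omega
        obtain ⟨t', ht'⟩ := hpre
        exact hsx u hu ⟨s, t', ht'⟩
      · have hge : x.length + y.length ≤ s.length := by
          by_contra hcon
          rcases h1 with h1 | h1
          · rcases Nat.lt_or_ge x.length (s.length + u.length + 1) with h5 | h5
            · rcases Nat.lt_or_ge (x.length - s.length) u.length with h6 | h6
              · have := (hall (x.length - s.length) h6).1.1 (hex _ h6)
                omega
              · have := (hall 0 hupos).2.1 (hex _ hupos)
                omega
            · have h6 : x.length - s.length - u.length < u.length := by omega
              have := (hall _ h6).2.1 (hex _ h6)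
              omega
          · omega
        have hsuf : (u ++ u) ++ t <:+ z := by
          refine List.suffix_of_suffix_length_le (l₃ := x ++ y ++ z)
            ⟨s, by rw [← hst]; simp⟩ ⟨x ++ y, rfl⟩ ?_
          simp only [List.length_append]
          omega
        obtain ⟨s', hs'⟩ := hsuf
        exact hsz u hu ⟨s', t, by rw [← hs']; simp⟩
  obtain ⟨k, rfl⟩ := hw.symm
  rw [← List.rotate_mod]
  have hn : k % (a ++ b).length ≤ (a ++ b).length :=
    (Nat.mod_lt _ (List.length_pos_iff.2 (by simp [ha0]))).le
  generalize k % (a ++ b).length = n at hn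
  rw [List.length_append] at hn
  rw [List.rotate_eq_drop_append_take (by simpa using hn)]
  rcases Nat.le_total n a.length with h | h
  · rw [List.drop_append_of_le_length h, List.take_append_of_le_length h]
    exact key p _ _ _ (fun c hc => ha c (List.mem_of_mem_drop hc))
      (fun c hc => ha c (List.mem_of_mem_take hc)) hb (hsa.infix (List.drop_suffix _ _).isInfix)
      hsb (hsa.infix (List.take_prefix _ _).isInfix) hb0
  · obtain ⟨k, rfl⟩ := Nat.exists_eq_add_of_le h
    rw [List.drop_append, List.take_append, List.drop_eq_nil_of_le (by omega),
      List.take_of_length_le (by omega), Nat.add_sub_cancel_left, List.nil_append,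
      ← List.append_assoc]
    exact key (fun c => !p c) _ _ _ (fun c hc => by simpa using hb c (List.mem_of_mem_drop hc))
      (fun c hc => by simpa using hb c (List.mem_of_mem_take hc)) (by simpa using ha)
      (hsb.infix (List.drop_suffix _ _).isInfix) hsa (hsb.infix (List.take_prefix _ _).isInfix) ha0

end SquareFree

/-! ### Cyclic words with prescribed turns. -/

section CyclicChain

variable {α : Type*} {R : Letter α → Letter α → Prop} {w : List (Letter α)}

theorem isChain_of_isRotated (hw : Cycle.Chain R (w : Cycle (Letter α))) {w' : List (Letter α)}
    (h : w' ~r w) : w'.IsChain R := by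
  rw [← Cycle.coe_eq_coe.2 h] at hw
  cases w' with
  | nil => exact List.isChain_nil
  | cons a l =>
    rw [Cycle.chain_coe_cons] at hw
    exact hw.infix ⟨[], [a], by simp⟩

theorem rel_of_isCyclicFactor (hw : Cycle.Chain R (w : Cycle (Letter α))) {x y : Letter α}
    (h : IsCyclicFactor [x, y] w) : R x y := by
  obtain ⟨w', hw', h⟩ := h
  simpa using (isChain_of_isRotated hw hw').infix h

theorem isCyclicallyReduced_of_chain (hR : ∀ x y, R x y → ¬ R y.inv x.inv)
    (hw : Cycle.Chain R (w : Cycle (Letter α))) : FreeGroup.IsCyclicallyReduced w := by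
  refine ⟨isReduced_of_isChain hR (isChain_of_isRotated hw (List.IsRotated.refl w)), ?_⟩
  intro a ha b hb
  have hne : w ≠ [] := by rintro rfl; simp at ha
  rw [Cycle.chain_ne_nil R hne] at hw
  rw [List.getLast?_eq_some_getLast hne, Option.mem_def, Option.some.injEq] at ha
  cases w with
  | nil => simp at hb
  | cons c l =>
    simp only [List.head?_cons, Option.mem_def, Option.some.injEq] at hb
    subst hb
    rw [ha] at hw
    have := isReduced_of_isChain hR hw
    unfold FreeGroup.IsReduced at this
    rw [List.isChain_cons_cons] at this
    exact this.1

end CyclicChain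

/-! ### The table of admissible turns and its consequences. -/

section TurnRelation

/-- The turns of the words constructed below, by the kinds `c, x, x', y, z, s` of their letters. -/
def kindTurns : List (Letter (Fin 6) × Letter (Fin 6)) :=
  [((0, false), (2, true)), ((2, true), (3, true)), ((3, true), (4, true)),
    ((4, true), (2, false)), ((2, false), (1, false)), ((1, false), (3, false)),
    ((3, false), (4, false)), ((4, false), (1, true)), ((1, true), (0, true)),
    ((5, true), (2, true)), ((5, false), (2, true)), ((1, true), (5, true)),
    ((1, true), (5, false)), ((5, true), (0, false)), ((0, true), (5, true)),
    ((5, false), (5, false))]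

variable {α : Type*}

/-- The relation of being a turn of the words constructed below, for letters of kinds `k`. -/
def TurnRel (k : α → Fin 6) (x y : Letter α) : Prop :=
  ((k x.1, x.2), (k y.1, y.2)) ∈ kindTurns

/-- This finite check serves three purposes: cyclic reducedness, condition (iii) for Wicks forms,
and positivity of every turn in the genus bound. -/
theorem TurnRel.not_inv {k : α → Fin 6} (x y : Letter α) (h : TurnRel k x y) :
    ¬ TurnRel k y.inv x.inv := by
  have key : ∀ p ∈ kindTurns, (p.2.inv, p.1.inv) ∉ kindTurns := by
    simp only [kindTurns, Letter.inv]
    decide +kernel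
  exact key _ h

/-- The place of a letter between two letters of kind `s`. -/
def kindPlace : Letter (Fin 6) → ℕ
  | (0, false) => 0
  | (2, true) => 1
  | (3, true) => 2
  | (4, true) => 3
  | (2, false) => 4
  | (1, false) => 5
  | (3, false) => 6
  | (4, false) => 7
  | (1, true) => 8
  | _ => 9

theorem TurnRel.place_lt {k : α → Fin 6} {x y : Letter α} (h : TurnRel k x y) (hx : k x.1 ≠ 5)
    (hy : k y.1 ≠ 5) : kindPlace (k x.1, x.2) < kindPlace (k y.1, y.2) := by
  have key : ∀ p ∈ kindTurns, p.1.1 ≠ 5 → p.2.1 ≠ 5 → kindPlace p.1 < kindPlace p.2 := by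
    simp only [kindTurns]
    decide +kernel
  exact key _ h hx hy

/-- If `u` has no letter of kind 5, `kindPlace` increases strictly along `uu`, so no letter of `u`
can recur. Otherwise filtering keeps a nonempty square, in a rotation of `a ++ b`. -/
theorem isSquareFree_of_turnRel {k : α → Fin 6} {w a b : List (Letter α)}
    (hw : Cycle.Chain (TurnRel k) (w : Cycle (Letter α)))
    (hfilter : w.filter (fun x => decide (k x.1 = 5)) = a ++ b) (ha : ∀ x ∈ a, x.2 = true)
    (hb : ∀ x ∈ b, x.2 = false) (hsa : IsSquareFree a) (hsb : IsSquareFree b) (ha0 : a ≠ [])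
    (hb0 : b ≠ []) {w' : List (Letter α)} (hw' : w' ~r w) : IsSquareFree w' := by
  have hrot : w'.filter (fun x => decide (k x.1 = 5)) ~r a ++ b := by
    rw [← hfilter]
    obtain ⟨n, rfl⟩ := hw'
    rcases eq_or_ne w' [] with rfl | h0
    · simp
    · rw [← List.rotate_mod, List.rotate_eq_drop_append_take
        (Nat.mod_lt _ (List.length_pos_iff.2 h0)).le, List.filter_append]
      nth_rewrite 1 [← List.take_append_drop (n % w'.length) w']
      rw [List.filter_append]
      exact List.isRotated_append
  have hsq := isSquareFree_of_isRotated_append (p := Prod.snd) ha (by simpa using hb) hsa hsb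
    ha0 hb0 hrot
  intro u hu huu
  have hinf := List.IsInfix.filter (fun x => decide (k x.1 = 5)) huu
  rw [List.filter_append] at hinf
  by_cases hfu : u.filter (fun x => decide (k x.1 = 5)) = []
  · have hne : ∀ x ∈ u ++ u, k x.1 ≠ 5 := by
      intro x hx
      have := List.filter_eq_nil_iff.1 hfu x (by simpa using hx)
      simpa using this
    have hchain := (isChain_of_isRotated hw hw').infix huu
    have hlt : (u ++ u).IsChain fun x y =>
        kindPlace (k x.1, x.2) < kindPlace (k y.1, y.2) := by
      refine List.IsChain.imp_of_mem_imp (fun x y hx hy h => h.place_lt (hne x hx) (hne y hy)) hchain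
    have : IsTrans (Letter α) fun x y => kindPlace (k x.1, x.2) < kindPlace (k y.1, y.2) :=
      ⟨fun _ _ _ h1 h2 => h1.trans h2⟩
    rw [List.isChain_iff_pairwise, List.pairwise_append] at hlt
    obtain ⟨x, hx⟩ := List.exists_mem_of_ne_nil u hu
    exact lt_irrefl _ (hlt.2.2 x hx x hx)
  · exact hsq _ hfu hinf

end TurnRelation

/-! ### Counting vertices when all of them have degree three. -/

section Vertices

/-- The classes are the orbits of `τ`, which has order 3 and no fixed points, so each has exactly
three elements. -/
theorem three_mul_card_quot {n : ℕ} (r : Fin n → Fin n → Prop) (τ : Fin n → Fin n)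
    (hr : ∀ i j, r i j ↔ j = τ i) (hτ : ∀ i, τ (τ (τ i)) = i) (hne : ∀ i, τ i ≠ i) :
    3 * Nat.card (Quot r) = n := by
  classical
  have : Finite (Quot r) := Finite.of_surjective _ Quot.mk_surjective
  have := Fintype.ofFinite (Quot r)
  let orb : Fin n → Finset (Fin n) := fun i => {i, τ i, τ (τ i)}
  have horb : ∀ i j, r i j → orb i = orb j := by
    intro i j hij
    rw [hr] at hij
    subst hij
    ext k
    simp only [orb, Finset.mem_insert, Finset.mem_singleton, hτ]
    tauto
  have hfiber : ∀ q : Quot r, (Finset.univ.filter fun i => Quot.mk r i = q).card = 3 := by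
    intro q
    induction q using Quot.inductionOn with
    | _ i =>
    have : (Finset.univ.filter fun j => Quot.mk r j = Quot.mk r i) = orb i := by
      ext j
      simp only [Finset.mem_filter, Finset.mem_univ, true_and]
      constructor
      · intro h
        have h' : orb j = orb i := congrArg (Quot.lift orb horb) h
        rw [← h']
        simp [orb]
      · have h1 : ∀ i, Quot.mk r (τ i) = Quot.mk r i := fun i =>
          (Quot.sound ((hr _ _).2 rfl)).symm
        simp only [orb, Finset.mem_insert, Finset.mem_singleton]
        rintro (rfl | rfl | rfl)
        · rfl
        · exact h1 i
        · rw [h1, h1]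
    rw [this, Finset.card_eq_three]
    refine ⟨i, τ i, τ (τ i), (hne i).symm, ?_, (hne _).symm, rfl⟩
    intro h
    apply hne i
    nth_rewrite 1 [h]
    exact hτ i
  have h1 := Finset.card_eq_sum_card_fiberwise (f := Quot.mk r) (s := Finset.univ)
    (t := Finset.univ) (fun _ _ => Finset.mem_univ _)
  rw [Finset.sum_congr rfl fun q _ => hfiber q] at h1
  simp only [Finset.card_univ, Fintype.card_fin, Finset.sum_const, smul_eq_mul] at h1
  rw [Nat.card_eq_fintype_card]
  omega

/-- If the side following `x` in the polygon of `u` is `nxt x`, the next corner at a vertex after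
the one in front of `x` is in front of `nxt x⁻¹`; if all vertices have degree three their number is
a third of the length of `u`. -/
theorem three_mul_numVertices {u : List (Letter ℕ)} (hu : u.Nodup) (hinv : ∀ x ∈ u, x.inv ∈ u)
    (nxt : Letter ℕ → Letter ℕ) (hnxt : ∀ i, u.get (finRotate _ i) = nxt (u.get i))
    (h3 : ∀ x ∈ u, nxt (nxt (nxt x.inv).inv).inv = x) (hne : ∀ x ∈ u, nxt x.inv ≠ x) :
    3 * numVertices u = u.length := by
  have hinj := List.nodup_iff_injective_get.1 hu
  have hp : ∀ i, ∃ p, u.get p = (u.get i).inv := fun i => by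
    obtain ⟨p, hp⟩ := List.get_of_mem (hinv _ (List.get_mem u i))
    exact ⟨p, hp⟩
  choose p hp using hp
  have hτ : ∀ i, u.get (finRotate _ (p i)) = nxt (u.get i).inv := fun i => by rw [hnxt, hp]
  refine three_mul_card_quot (Glued u) (fun i => finRotate _ (p i)) (fun i j => ⟨?_, ?_⟩) ?_ ?_
  · rintro ⟨q, hq, rfl⟩
    rw [hinj (hq.trans (hp i).symm)]
  · rintro rfl
    exact ⟨p i, hp i, rfl⟩
  · intro i
    apply hinj
    rw [hτ, hτ, hτ, h3 _ (List.get_mem u i)]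
  · intro i h
    apply hne _ (List.get_mem u i)
    rw [← hτ, h]

end Vertices

/-! ### The caterpillar surfaces and their boundary words. -/

section Forms

/-- The edges of the graphs on the surfaces constructed below: a caterpillar with spine edges `s t`
and leaf edges `c t`, at whose leaves there are handles with edges `x t`, `x' t`, `y t`, `z t`. -/
inductive Edge where
  | c (t : ℕ)
  | x (t : ℕ)
  | x' (t : ℕ)
  | y (t : ℕ)
  | z (t : ℕ)
  | s (t : ℕ)

namespace Edge

/-- The kind of an edge. -/
def kind : Edge → Fin 6
  | c _ => 0
  | x _ => 1
  | x' _ => 2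
  | y _ => 3
  | z _ => 4
  | s _ => 5

/-- The place of an edge among those of its kind. -/
def index : Edge → ℕ
  | c t => t
  | x t => t
  | x' t => t
  | y t => t
  | z t => t
  | s t => t

/-- Edges as letters of the alphabet of Wicks forms. -/
def code (e : Edge) : ℕ := 6 * e.index + e.kind

theorem code_mod (e : Edge) : e.code % 6 = e.kind := by
  have := e.kind.2
  unfold code
  omega

theorem code_div (e : Edge) : e.code / 6 = e.index := by
  have := e.kind.2
  unfold code
  omega

theorem code_injective : Function.Injective code := by
  intro e f h
  have h1 : e.kind = f.kind := Fin.ext (by rw [← code_mod, ← code_mod, h])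
  have h2 : e.index = f.index := by rw [← code_div, ← code_div, h]
  cases e <;> cases f <;> simp_all [kind, index]

/-- The edges that occur in the form of genus `m + 2`. -/
def IsIn (m : ℕ) : Edge → Prop
  | c t => 1 ≤ t ∧ t ≤ m
  | x t => t ≤ m + 1
  | x' t => t ≤ m + 1
  | y t => t ≤ m + 1
  | z t => t ≤ m + 1
  | s t => 1 ≤ t ∧ t ≤ m + 1

end Edge

open Edge

/-- The boundary of the handle at a leaf. -/
def handle (P R : Equiv.Perm ℕ) (t : ℕ) : List (Letter Edge) :=
  [(x' t, true), (y t, true), (z t, true), (x' (P t), false), (x (P t), false),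
    (y (R (P t)), false), (z (R t), false), (x t, true)]

/-- The walk along the upper side of the spine. -/
def upper (P R : Equiv.Perm ℕ) : ℕ → List (Letter Edge)
  | 0 => handle P R 0
  | k + 1 => upper P R k ++
      ([(s (k + 1), true), (c (k + 1), false)] ++ handle P R (k + 1) ++ [(c (k + 1), true)])

/-- The walk back along the lower side of the spine. -/
def lower : ℕ → List (Letter Edge)
  | 0 => []
  | k + 1 => (s (k + 1), false) :: lower k

/-- The boundary word of the surface of genus `m + 2`. -/
def boundary (m : ℕ) (P R : Equiv.Perm ℕ) : List (Letter Edge) :=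
  upper P R m ++ ((s (m + 1), true) :: (handle P R (m + 1) ++ lower (m + 1)))

/-- The successor of a letter in the boundary word. -/
def nextSide (m : ℕ) (P R : Equiv.Perm ℕ) : Letter Edge → Letter Edge
  | (x' t, true) => (y t, true)
  | (y t, true) => (z t, true)
  | (z t, true) => (x' (P t), false)
  | (x' t, false) => (x t, false)
  | (x t, false) => (y (R t), false)
  | (y t, false) => (z (P.symm t), false)
  | (z t, false) => (x (R.symm t), true)
  | (x t, true) =>
    if t = 0 then (s 1, true) else if t = m + 1 then (s (m + 1), false) else (c t, true)
  | (c t, true) => (s (t + 1), true)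
  | (s t, true) => if t = m + 1 then (x' t, true) else (c t, false)
  | (c t, false) => (x' t, true)
  | (s t, false) => if t = 1 then (x' 0, true) else (s (t - 1), false)

/-- A function increasing along the boundary word. -/
def sideRank (m : ℕ) (P R : Equiv.Perm ℕ) : Letter Edge → ℕ
  | (x' t, true) => 20 * t + 2
  | (y t, true) => 20 * t + 3
  | (z t, true) => 20 * t + 4
  | (x' t, false) => 20 * P.symm t + 5
  | (x t, false) => 20 * P.symm t + 6
  | (y t, false) => 20 * P.symm (R.symm t) + 7
  | (z t, false) => 20 * R.symm t + 8
  | (x t, true) => 20 * t + 9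
  | (c t, true) => 20 * t + 10
  | (s t, true) => 20 * t
  | (c t, false) => 20 * t + 1
  | (s t, false) => 20 * (m + 2) + (m + 1 - t)

theorem length_upper (P R : Equiv.Perm ℕ) (k : ℕ) : (upper P R k).length = 11 * k + 8 := by
  induction k with
  | zero => rfl
  | succ k ih => simp [upper, handle, ih]; ring

theorem length_lower (k : ℕ) : (lower k).length = k := by
  induction k with
  | zero => rfl
  | succ k ih => simp [lower, ih]

theorem length_boundary (m : ℕ) (P R : Equiv.Perm ℕ) :
    (boundary m P R).length = 12 * m + 18 := by
  simp [boundary, length_upper, length_lower, handle]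
  ring

theorem mem_upper {P R : Equiv.Perm ℕ} {k : ℕ} {a : Letter Edge} :
    a ∈ upper P R k ↔ (∃ t ≤ k, a ∈ handle P R t) ∨
      ∃ t, 1 ≤ t ∧ t ≤ k ∧ (a = (s t, true) ∨ a = (c t, false) ∨ a = (c t, true)) := by
  induction k with
  | zero => simp [upper]
  | succ k ih =>
    simp only [upper, List.mem_append, ih, List.mem_cons, List.not_mem_nil, or_false]
    constructor
    · rintro ((⟨t, ht, h⟩ | ⟨t, h1, h2, h⟩) | ((h | h) | h) | h)
      · exact Or.inl ⟨t, by omega, h⟩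
      · exact Or.inr ⟨t, h1, by omega, h⟩
      · exact Or.inr ⟨k + 1, by omega, le_rfl, by tauto⟩
      · exact Or.inr ⟨k + 1, by omega, le_rfl, by tauto⟩
      · exact Or.inl ⟨k + 1, le_rfl, h⟩
      · exact Or.inr ⟨k + 1, by omega, le_rfl, by tauto⟩
    · rintro (⟨t, ht, h⟩ | ⟨t, h1, h2, h⟩)
      · rcases Nat.lt_or_ge t (k + 1) with h' | h'
        · exact Or.inl (Or.inl ⟨t, by omega, h⟩)
        · obtain rfl : t = k + 1 := by omega
          tauto
      · rcases Nat.lt_or_ge t (k + 1) with h' | h'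
        · exact Or.inl (Or.inr ⟨t, h1, by omega, h⟩)
        · obtain rfl : t = k + 1 := by omega
          tauto

theorem mem_lower {k : ℕ} {a : Letter Edge} :
    a ∈ lower k ↔ ∃ t, 1 ≤ t ∧ t ≤ k ∧ a = (s t, false) := by
  induction k with
  | zero => simp [lower]
  | succ k ih =>
    simp only [lower, List.mem_cons, ih]
    constructor
    · rintro (h | ⟨t, h1, h2, h⟩)
      · exact ⟨k + 1, by omega, le_rfl, h⟩
      · exact ⟨t, h1, by omega, h⟩
    · rintro ⟨t, h1, h2, h⟩
      rcases Nat.lt_or_ge t (k + 1) with h' | h'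
      · exact Or.inr ⟨t, h1, by omega, h⟩
      · obtain rfl : t = k + 1 := by omega
        exact Or.inl h

/-- Permutations of the handles of the surface of genus `m + 2`. -/
def Preserves (m : ℕ) (P : Equiv.Perm ℕ) : Prop := ∀ t, P t ≤ m + 1 ↔ t ≤ m + 1

theorem Preserves.symm {m : ℕ} {P : Equiv.Perm ℕ} (h : Preserves m P) : Preserves m P.symm :=
  fun t => by rw [← h, Equiv.apply_symm_apply]

theorem mem_boundary {m : ℕ} {P R : Equiv.Perm ℕ} (hP : Preserves m P) (hR : Preserves m R)
    (a : Letter Edge) : a ∈ boundary m P R ↔ a.1.IsIn m := by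
  have h1 : a ∈ boundary m P R ↔ (∃ t ≤ m + 1, a ∈ handle P R t) ∨
      (∃ t, 1 ≤ t ∧ t ≤ m ∧ (a = (c t, false) ∨ a = (c t, true))) ∨
      ∃ t, 1 ≤ t ∧ t ≤ m + 1 ∧ (a = (s t, true) ∨ a = (s t, false)) := by
    simp only [boundary, List.mem_append, List.mem_cons, mem_upper, mem_lower]
    constructor
    · rintro ((⟨t, ht, h⟩ | ⟨t, h1, h2, h | h⟩) | h | h | ⟨t, h1, h2, h⟩)
      · exact Or.inl ⟨t, by omega, h⟩
      · exact Or.inr (Or.inr ⟨t, h1, by omega, Or.inl h⟩)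
      · exact Or.inr (Or.inl ⟨t, h1, h2, h⟩)
      · exact Or.inr (Or.inr ⟨m + 1, by omega, le_rfl, Or.inl h⟩)
      · exact Or.inl ⟨m + 1, le_rfl, h⟩
      · exact Or.inr (Or.inr ⟨t, h1, h2, Or.inr h⟩)
    · rintro (⟨t, ht, h⟩ | ⟨t, h1, h2, h⟩ | ⟨t, h1, h2, h | h⟩)
      · rcases Nat.lt_or_ge t (m + 1) with h' | h'
        · exact Or.inl (Or.inl ⟨t, by omega, h⟩)
        · obtain rfl : t = m + 1 := by omega
          tauto
      · exact Or.inl (Or.inr ⟨t, h1, h2, Or.inr h⟩)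
      · rcases Nat.lt_or_ge t (m + 1) with h' | h'
        · exact Or.inl (Or.inr ⟨t, h1, by omega, Or.inl h⟩)
        · obtain rfl : t = m + 1 := by omega
          tauto
      · exact Or.inr (Or.inr (Or.inr ⟨t, h1, h2, h⟩))
  rw [h1]
  clear h1
  constructor
  · rintro (⟨t, ht, h⟩ | ⟨t, h1, h2, h⟩ | ⟨t, h1, h2, h⟩)
    · have h3 := (hP t).2 ht
      have h4 := (hR t).2 ht
      have h5 := (hR _).2 h3
      simp only [handle, List.mem_cons, List.not_mem_nil, or_false] at h
      rcases h with rfl | rfl | rfl | rfl | rfl | rfl | rfl | rfl <;> assumption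
    · rcases h with rfl | rfl <;> exact ⟨h1, h2⟩
    · rcases h with rfl | rfl <;> exact ⟨h1, h2⟩
  · have hP' := hP.symm
    have hR' := hR.symm
    obtain ⟨e, b⟩ := a
    intro h
    cases e with
    | c t => exact Or.inr (Or.inl ⟨t, h.1, h.2, by cases b <;> simp⟩)
    | s t => exact Or.inr (Or.inr ⟨t, h.1, h.2, by cases b <;> simp⟩)
    | x t =>
      cases b
      · exact Or.inl ⟨P.symm t, (hP' t).2 h, by simp [handle]⟩
      · exact Or.inl ⟨t, h, by simp [handle]⟩
    | x' t =>
      cases b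
      · exact Or.inl ⟨P.symm t, (hP' t).2 h, by simp [handle]⟩
      · exact Or.inl ⟨t, h, by simp [handle]⟩
    | y t =>
      cases b
      · exact Or.inl ⟨P.symm (R.symm t), (hP' _).2 ((hR' t).2 h), by simp [handle]⟩
      · exact Or.inl ⟨t, h, by simp [handle]⟩
    | z t =>
      cases b
      · exact Or.inl ⟨R.symm t, (hR' t).2 h, by simp [handle]⟩
      · exact Or.inl ⟨t, h, by simp [handle]⟩

variable {m : ℕ} {P R : Equiv.Perm ℕ}

theorem symm_apply_symm_apply (hPR : Commute P R) (t : ℕ) :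
    P.symm (R.symm t) = R.symm (P.symm t) := by
  apply R.injective
  apply P.injective
  have h := congrArg (fun f : Equiv.Perm ℕ => f (P.symm (R.symm t))) hPR.eq
  simp only [Equiv.Perm.mul_apply] at h
  simp [h]

/-- Commutativity enters at one turn: `nextSide` sends the inverse of `y (R (P t))` to that of `z
(P.symm (R (P t)))`, which must be that of `z (R t)`. -/
theorem isChain_handle (hPR : Commute P R) (t : ℕ) :
    (handle P R t).IsChain fun a b => b = nextSide m P R a := by
  have h := congrArg (fun f : Equiv.Perm ℕ => f t) hPR.eq
  simp only [Equiv.Perm.mul_apply] at h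
  simp [handle, nextSide, ← h]

theorem isChain_lower (k : ℕ) : (lower k).IsChain fun a b => b = nextSide m P R a := by
  induction k with
  | zero => exact List.isChain_nil
  | succ k ih =>
    cases k with
    | zero => exact List.isChain_singleton _
    | succ k => exact List.isChain_cons_cons.2 ⟨by simp [nextSide], ih⟩

theorem isChain_upper (hPR : Commute P R) (k : ℕ) (hk : k ≤ m) :
    ((upper P R k).IsChain fun a b => b = nextSide m P R a) ∧
      ∀ a ∈ (upper P R k).getLast?, nextSide m P R a = (s (k + 1), true) := by
  induction k with
  | zero => exact ⟨isChain_handle hPR 0, by simp [upper, handle, nextSide]⟩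
  | succ k ih =>
    obtain ⟨h1, h2⟩ := ih (by omega)
    constructor
    · rw [upper, List.isChain_append, List.isChain_append, List.isChain_append]
      refine ⟨h1, ⟨⟨?_, isChain_handle hPR _, ?_⟩, List.isChain_singleton _, ?_⟩, ?_⟩
      · simp [nextSide]; omega
      · simp [nextSide, handle]
      · simp [nextSide, handle]; omega
      · simpa using fun a ha => (h2 a ha).symm
    · rw [upper, ← List.append_assoc, List.getLast?_concat]
      simp [nextSide]

theorem head_boundary : ∃ l, boundary m P R = (x' 0, true) :: l := by
  have : ∀ k, ∃ l, upper P R k = (x' 0, true) :: l := by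
    intro k
    induction k with
    | zero => exact ⟨_, rfl⟩
    | succ k ih =>
      obtain ⟨l, hl⟩ := ih
      exact ⟨_, by rw [upper, hl]; rfl⟩
  obtain ⟨l, hl⟩ := this m
  exact ⟨_, by rw [boundary, hl]; rfl⟩

theorem getLast_lower (k : ℕ) : ∃ l, lower (k + 1) = l ++ [(s 1, false)] := by
  induction k with
  | zero => exact ⟨[], rfl⟩
  | succ k ih =>
    obtain ⟨l, hl⟩ := ih
    exact ⟨_ :: l, by rw [lower, hl]; rfl⟩

theorem getLast_boundary : ∃ l, boundary m P R = l ++ [(s 1, false)] := by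
  obtain ⟨l, hl⟩ := getLast_lower m
  exact ⟨upper P R m ++ ((s (m + 1), true) :: (handle P R (m + 1) ++ l)), by simp [boundary, hl]⟩

theorem isChain_boundary (hPR : Commute P R) :
    (boundary m P R).IsChain fun a b => b = nextSide m P R a := by
  obtain ⟨h1, h2⟩ := isChain_upper (m := m) hPR m le_rfl
  rw [boundary, List.isChain_append, ← List.singleton_append, List.isChain_append,
    List.isChain_append]
  refine ⟨h1, ⟨List.isChain_singleton _, ⟨isChain_handle hPR _, isChain_lower _, ?_⟩, ?_⟩, ?_⟩
  · simp [handle, lower, nextSide]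
  · simp [handle, nextSide]
  · simpa using fun a ha => (h2 a ha).symm

theorem chain_boundary (hPR : Commute P R) :
    Cycle.Chain (fun a b => b = nextSide m P R a) (boundary m P R : Cycle (Letter Edge)) := by
  obtain ⟨l, hl⟩ := head_boundary (m := m) (P := P) (R := R)
  obtain ⟨l', hl'⟩ := getLast_boundary (m := m) (P := P) (R := R)
  have h := isChain_boundary (m := m) hPR
  have h2 : (boundary m P R ++ [(x' 0, true)]).IsChain fun a b => b = nextSide m P R a := by
    rw [List.isChain_append]
    refine ⟨h, List.isChain_singleton _, ?_⟩
    rw [hl']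
    simp [nextSide]
  rw [hl] at h2 ⊢
  exact (Cycle.chain_coe_cons _ _ _).2 h2

theorem turnRel_nextSide (a : Letter Edge) : TurnRel Edge.kind a (nextSide m P R a) := by
  rcases a with ⟨_ | _ | _ | _ | _ | _, _ | _⟩ <;> simp only [nextSide] <;>
    (try split_ifs) <;> simp [TurnRel, kindTurns, Edge.kind]

/-- The excluded letter is the last of the boundary word, where the cyclic order wraps around. -/
theorem sideRank_lt (hPR : Commute P R) {a : Letter Edge} (ha : a.1.IsIn m)
    (ha' : a ≠ (s 1, false)) : sideRank m P R a < sideRank m P R (nextSide m P R a) := by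
  rcases a with ⟨t | t | t | t | t | t, _ | _⟩ <;> simp only [Edge.IsIn] at ha <;>
    simp only [nextSide] <;> (try split_ifs) <;>
    simp_all [sideRank, symm_apply_symm_apply hPR] <;> omega

theorem nodup_lower (k : ℕ) : (lower k).Nodup := by
  induction k with
  | zero => exact List.nodup_nil
  | succ k ih =>
    refine List.nodup_cons.2 ⟨fun h => ?_, ih⟩
    obtain ⟨t, h1, h2, h⟩ := mem_lower.1 h
    simp at h
    omega

theorem nodup_boundary (hP : Preserves m P) (hR : Preserves m R) (hPR : Commute P R) :
    (boundary m P R).Nodup := by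
  have hsplit : boundary m P R =
      (upper P R m ++ ((s (m + 1), true) :: handle P R (m + 1))) ++ lower (m + 1) := by
    simp [boundary]
  have hmem : ∀ a ∈ upper P R m ++ ((s (m + 1), true) :: handle P R (m + 1)),
      ∀ t, a ≠ (s t, false) := by
    rintro a ha t rfl
    simp [mem_upper, handle] at ha
  have hchain := isChain_boundary (m := m) hPR
  have hin := fun a => (mem_boundary hP hR a).1
  rw [hsplit] at hchain hin ⊢
  rw [List.nodup_append']
  refine ⟨?_, nodup_lower _, fun a h1 h2 => ?_⟩
  · have h := List.IsChain.imp_of_mem_imp (S := fun a b => sideRank m P R a < sideRank m P R b)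
      (fun a b ha _ hab => by
        rw [hab]
        exact sideRank_lt hPR (hin a (List.mem_append_left _ ha)) (hmem a ha 1))
      (List.isChain_append.1 hchain).1
    have : IsTrans (Letter Edge) fun a b => sideRank m P R a < sideRank m P R b :=
      ⟨fun _ _ _ h1 h2 => h1.trans h2⟩
    rw [List.isChain_iff_pairwise] at h
    exact h.imp fun hab => by rintro rfl; exact lt_irrefl _ hab
  · obtain ⟨t, -, -, h⟩ := mem_lower.1 h2
    exact hmem a h1 t h

/-- Turning three times about a vertex returns to the start: every vertex of the graph has degree
three. -/
theorem nextSide_triangle (hPR : Commute P R) {a : Letter Edge} (ha : a.1.IsIn m) :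
    nextSide m P R (nextSide m P R (nextSide m P R a.inv).inv).inv = a := by
  have h : ∀ t, P (R t) = R (P t) := fun t =>
    congrArg (fun f : Equiv.Perm ℕ => f t) hPR.eq
  have h' : ∀ t, P (R.symm t) = R.symm (P t) := fun t => by
    rw [Equiv.eq_symm_apply, ← h, Equiv.apply_symm_apply]
  have h'' := symm_apply_symm_apply hPR
  rcases a with ⟨t | t | t | t | t | t, _ | _⟩
  all_goals
    simp only [Edge.IsIn] at ha
    have h2 : t ≠ m + 2 := by omega
    by_cases h0 : t = 0 <;> by_cases h1 : t = 1 <;> by_cases hm : t = m + 1 <;>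
    simp_all [Letter.inv, nextSide]

end Forms

/-! ### The boundary words as maximal Wicks forms. -/

section FormWords

theorem get_finRotate_of_chain {α : Type*} {f : α → α} {u : List α}
    (h : Cycle.Chain (fun a b => b = f a) (u : Cycle α)) (i : Fin u.length) :
    u.get (finRotate _ i) = f (u.get i) := by
  cases u with
  | nil => exact i.elim0
  | cons a l =>
    rw [Cycle.chain_coe_cons, ← List.cons_append, List.isChain_iff_getElem] at h
    obtain ⟨i, hi⟩ := i
    have h' := h i (by simpa using hi)
    rcases Nat.lt_or_ge (i + 1) (a :: l).length with h1 | h1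
    · rw [finRotate_mk_of_lt h1]
      rw [List.getElem_append_left h1, List.getElem_append_left hi] at h'
      exact h'
    · have h2 : i + 1 = (a :: l).length := by omega
      rw [finRotate_mk_last h2]
      rw [List.getElem_append_right h1, List.getElem_append_left hi] at h'
      simpa using h'

/-- The letters of the sides in the alphabet of Wicks forms. -/
def codeLetter (a : Letter Edge) : Letter ℕ := (a.1.code, a.2)

theorem codeLetter_inv (a : Letter Edge) : codeLetter a.inv = (codeLetter a).inv := rfl

theorem codeLetter_injective : Function.Injective codeLetter := by
  rintro ⟨e, b⟩ ⟨e', b'⟩ h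
  simp only [codeLetter, Prod.mk.injEq] at h
  rw [Edge.code_injective h.1, h.2]

/-- The Wicks form of genus `m + 2` belonging to two commuting permutations of the handles. -/
def formWord (m : ℕ) (P R : Equiv.Perm ℕ) : List (Letter ℕ) := (boundary m P R).map codeLetter

/-- The kind of a letter of a form. -/
def codeKind (n : ℕ) : Fin 6 := ⟨n % 6, Nat.mod_lt _ (by norm_num)⟩

theorem codeKind_code (e : Edge) : codeKind e.code = e.kind := Fin.ext e.code_mod

variable {m : ℕ} {P R : Equiv.Perm ℕ}

theorem chain_turnRel_boundary (hPR : Commute P R) :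
    Cycle.Chain (TurnRel Edge.kind) (boundary m P R : Cycle (Letter Edge)) :=
  (chain_boundary (m := m) hPR).imp fun a b h => by rw [h]; exact turnRel_nextSide a

theorem chain_turnRel_formWord (hPR : Commute P R) :
    Cycle.Chain (TurnRel codeKind) (formWord m P R : Cycle (Letter ℕ)) := by
  rw [formWord, ← Cycle.map_coe, Cycle.chain_map]
  refine (chain_turnRel_boundary hPR).imp fun a b h => ?_
  simpa only [TurnRel, codeLetter, codeKind_code] using h

theorem length_formWord : (formWord m P R).length = 12 * m + 18 := by
  rw [formWord, List.length_map, length_boundary]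

theorem nodup_formWord (hP : Preserves m P) (hR : Preserves m R) (hPR : Commute P R) :
    (formWord m P R).Nodup := (nodup_boundary hP hR hPR).map codeLetter_injective

theorem inv_mem_formWord (hP : Preserves m P) (hR : Preserves m R) {x : Letter ℕ}
    (hx : x ∈ formWord m P R) : x.inv ∈ formWord m P R := by
  obtain ⟨a, ha, rfl⟩ := List.mem_map.1 hx
  rw [← codeLetter_inv]
  refine List.mem_map_of_mem ?_
  rw [mem_boundary hP hR] at ha ⊢
  exact ha

theorem isWicksForm_formWord (hP : Preserves m P) (hR : Preserves m R) (hPR : Commute P R) :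
    IsWicksForm (formWord m P R) where
  count_inv _ hx := List.count_eq_one_of_mem (nodup_formWord hP hR hPR) (inv_mem_formWord hP hR hx)
  cyclicallyReduced := isCyclicallyReduced_of_chain TurnRel.not_inv (chain_turnRel_formWord hPR)
  factor _ _ h h' := TurnRel.not_inv _ _ (rel_of_isCyclicFactor (chain_turnRel_formWord hPR) h)
    (rel_of_isCyclicFactor (chain_turnRel_formWord hPR) h')

theorem numVertices_formWord (hP : Preserves m P) (hR : Preserves m R) (hPR : Commute P R) :
    3 * numVertices (formWord m P R) = 12 * m + 18 := by
  rw [← length_formWord (m := m) (P := P) (R := R)]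
  set nxt : Letter ℕ → Letter ℕ :=
    Function.extend codeLetter (fun a => codeLetter (nextSide m P R a)) id with hdef
  have hnxt : ∀ a, nxt (codeLetter a) = codeLetter (nextSide m P R a) := fun a =>
    codeLetter_injective.extend_apply _ _ a
  refine three_mul_numVertices (nodup_formWord hP hR hPR) (fun x => inv_mem_formWord hP hR) nxt
    (get_finRotate_of_chain ?_) ?_ ?_
  · rw [formWord, ← Cycle.map_coe, Cycle.chain_map]
    exact (chain_boundary hPR).imp fun a b h => by rw [h, hnxt]
  · intro x hx
    obtain ⟨a, ha, rfl⟩ := List.mem_map.1 hx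
    simp only [← codeLetter_inv, hnxt]
    rw [nextSide_triangle hPR ((mem_boundary hP hR a).1 ha)]
  · intro x hx h
    obtain ⟨a, ha, rfl⟩ := List.mem_map.1 hx
    rw [← codeLetter_inv, hnxt] at h
    have h1 := turnRel_nextSide (m := m) (P := P) (R := R) a.inv
    rw [codeLetter_injective h] at h1
    -- A fixed corner would produce a turn `a⁻¹a`, which is its own inverse.
    exact h1.not_inv _ _ (by simpa only [Letter.inv_inv] using h1)

theorem isMaximalWicksForm_formWord (hP : Preserves m P) (hR : Preserves m R)
    (hPR : Commute P R) : IsMaximalWicksForm (m + 2) (formWord m P R) := by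
  have h := numVertices_formWord hP hR hPR
  refine ⟨isWicksForm_formWord hP hR hPR, ⟨6 * m + 9, ?_, ?_⟩, ?_⟩
  · rw [length_formWord]; ring
  · push_cast
    omega
  · rw [length_formWord]
    push_cast
    ring

/-- `P` and `R` occur only in the indices of inverse handle letters. This is why all the forms
represent the same word, and why their positive letters stand at the same places. -/
theorem map_boundary_eq {γ : Type*} (q : Letter Edge → γ) (hq : ∀ t t',
    q (.x t, false) = q (.x t', false) ∧ q (.x' t, false) = q (.x' t', false) ∧
    q (.y t, false) = q (.y t', false) ∧ q (.z t, false) = q (.z t', false)) :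
    (boundary m P R).map q = (boundary m 1 1).map q := by
  have hhandle : ∀ t, (handle P R t).map q = (handle 1 1 t).map q := by
    intro t
    simp only [handle, List.map_cons, List.map_nil, (hq _ t).1, (hq _ t).2.1, (hq _ t).2.2.1,
      (hq _ t).2.2.2]
  have hupper : ∀ k, (upper P R k).map q = (upper 1 1 k).map q := by
    intro k
    induction k with
    | zero => exact hhandle 0
    | succ k ih => simp only [upper, List.map_append, ih, hhandle]
  simp only [boundary, List.map_append, List.map_cons, hhandle, hupper]

end FormWords

/-! ### The labelled words, their genus and square freeness. -/

section Words

/-- The letter labelling an edge: the spine edges are labelled by a sequence of `35` letters, the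
other edges by their kind. -/
def codeLabel (f : ℕ → Fin 35) (n : ℕ) : Fin 40 :=
  if n % 6 = 5 then (f (n / 6)).addNat 5 else ⟨n % 6, by omega⟩

/-- The kind of a letter. -/
def labelKind (i : Fin 40) : Fin 6 := ⟨min i 5, by omega⟩

theorem labelKind_codeLabel (f : ℕ → Fin 35) (n : ℕ) :
    labelKind (codeLabel f n) = codeKind n := by
  unfold codeLabel labelKind codeKind
  ext
  split_ifs with h
  · simp [h]
  · have := Nat.mod_lt n (show 6 > 0 by norm_num)
    simp
    omega

/-- The images of the letters of a form. -/
def labelLetter (f : ℕ → Fin 35) (x : Letter ℕ) : Letter (Fin 40) := (codeLabel f x.1, x.2)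

theorem subst_codeLabel (f : ℕ → Fin 35) (u : List (Letter ℕ)) :
    subst (fun n => [(codeLabel f n, true)]) u = u.map (labelLetter f) := by
  induction u with
  | nil => rfl
  | cons x u ih =>
    rw [List.map_cons, ← ih]
    rcases x with ⟨n, _ | _⟩ <;> simp [subst, labelLetter, FreeGroup.invRev]

/-- The word of genus `m + 2`. -/
def surfaceWord (f : ℕ → Fin 35) (m : ℕ) : List (Letter (Fin 40)) :=
  (formWord m 1 1).map (labelLetter f)

variable {f : ℕ → Fin 35} {m : ℕ} {P R : Equiv.Perm ℕ}

theorem labelLetter_codeLetter (a : Letter Edge) : labelLetter f (codeLetter a) =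
    (if a.1.kind = 5 then (f a.1.index).addNat 5 else ⟨a.1.kind, by omega⟩, a.2) := by
  simp only [labelLetter, codeLetter, codeLabel, Edge.code_mod, Edge.code_div]
  have : (a.1.kind : ℕ) = 5 ↔ a.1.kind = 5 := by
    rw [Fin.ext_iff]; rfl
  simp only [this]

theorem map_labelLetter_formWord : (formWord m P R).map (labelLetter f) = surfaceWord f m := by
  rw [surfaceWord, formWord, formWord, List.map_map, List.map_map]
  exact map_boundary_eq _ (by simp [labelLetter_codeLetter, Edge.kind])

theorem length_surfaceWord : (surfaceWord f m).length = 12 * m + 18 := by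
  rw [surfaceWord, List.length_map, length_formWord]

theorem chain_surfaceWord : Cycle.Chain (TurnRel labelKind)
    (surfaceWord f m : Cycle (Letter (Fin 40))) := by
  rw [surfaceWord, ← Cycle.map_coe, Cycle.chain_map]
  refine (chain_turnRel_formWord (Commute.one_left 1)).imp fun a b h => ?_
  simpa only [TurnRel, labelLetter, labelKind_codeLabel] using h

theorem isNonCancelling_surfaceWord (hP : Preserves m P) (hR : Preserves m R)
    (hPR : Commute P R) : IsNonCancellingWicksRepresentation (m + 2)
      (fun n => [(codeLabel f n, true)]) (formWord m P R) (surfaceWord f m) := by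
  have hmax := isMaximalWicksForm_formWord hP hR hPR
  have hred := isCyclicallyReduced_of_chain TurnRel.not_inv (chain_surfaceWord (f := f) (m := m))
  refine ⟨⟨hmax.1, hmax.2.1, _, List.IsRotated.refl _, fun _ => by simp [FreeGroup.IsReduced], ?_⟩,
    ?_⟩
  · rw [subst_codeLabel, map_labelLetter_formWord]
    exact hred.isReduced.reduce_eq
  · rwa [subst_codeLabel, map_labelLetter_formWord]

theorem hasGenus_surfaceWord : HasGenus (surfaceWord f m) (m + 2) := by
  have h1 : Preserves m 1 := fun _ => Iff.rfl
  refine ⟨⟨_, _, isNonCancelling_surfaceWord h1 h1 (Commute.one_left 1)⟩, fun k hk => ?_⟩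
  refine not_isWicksRepresentation_of_isChain TurnRel.not_inv
    (isChain_of_isRotated chain_surfaceWord (List.IsRotated.refl _)) ?_ hk
  rw [length_surfaceWord]
  ring

/-- The boundary walk traverses the whole spine forwards and then backwards. -/
theorem filter_surfaceWord :
    (surfaceWord f m).filter (fun x => decide (labelKind x.1 = 5)) =
      (List.range (m + 1)).map (fun t => ((f (t + 1)).addNat 5, true)) ++
      (List.range (m + 1)).reverse.map (fun t => ((f (t + 1)).addNat 5, false)) := by
  have hkind : ∀ a, labelKind (labelLetter f (codeLetter a)).1 = a.1.kind := by
    intro a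
    rw [← codeKind_code, ← labelKind_codeLabel f]
    rfl
  have hhandle : ∀ t, (handle 1 1 t).filter (fun a => decide (a.1.kind = 5)) = [] := by
    intro t
    simp [handle, Edge.kind]
  have hupper : ∀ k, ((upper 1 1 k).filter (fun a => decide (a.1.kind = 5))) =
      (List.range k).map fun t => (Edge.s (t + 1), true) := by
    intro k
    induction k with
    | zero => exact hhandle 0
    | succ k ih =>
      simp only [upper, List.filter_append, ih, hhandle, List.range_succ, List.map_append]
      simp [Edge.kind]
  have hlower : ∀ k, ((lower k).filter (fun a => decide (a.1.kind = 5))) =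
      (List.range k).reverse.map fun t => (Edge.s (t + 1), false) := by
    intro k
    induction k with
    | zero => rfl
    | succ k ih =>
      rw [lower, List.filter_cons_of_pos (by simp [Edge.kind]), ih, List.range_succ,
        List.reverse_append]
      rfl
  have hboundary : (boundary m 1 1).filter (fun a => decide (a.1.kind = 5)) =
      (List.range (m + 1)).map (fun t => (Edge.s (t + 1), true)) ++
      (List.range (m + 1)).reverse.map (fun t => (Edge.s (t + 1), false)) := by
    rw [boundary, List.filter_append, List.filter_cons_of_pos (by simp [Edge.kind]),
      List.filter_append, hhandle, hupper, hlower, List.nil_append, List.range_succ,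
      List.map_append, List.append_assoc]
    rfl
  rw [surfaceWord, formWord, List.map_map, List.filter_map]
  simp only [Function.comp_def, hkind, hboundary, List.map_append, List.map_map]
  simp only [labelLetter_codeLetter, Edge.kind, Edge.index, if_true]

theorem isSquareFree_surfaceWord (hf : IsSquareFree ((List.range (m + 1)).map fun t => f (t + 1)))
    {w : List (Letter (Fin 40))} (hw : w ~r surfaceWord f m) : IsSquareFree w := by
  have hinj : ∀ b : Bool, Function.Injective fun i : Fin 35 => ((i.addNat 5 : Fin 40), b) := by
    intro b i j h
    simpa [Fin.ext_iff] using h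
  refine isSquareFree_of_turnRel chain_surfaceWord filter_surfaceWord ?_ ?_ ?_ ?_ ?_ ?_ hw
  · intro x hx
    obtain ⟨t, -, rfl⟩ := List.mem_map.1 hx
    rfl
  · intro x hx
    obtain ⟨t, -, rfl⟩ := List.mem_map.1 hx
    rfl
  · simpa [Function.comp_def] using hf.map (hinj true)
  · simpa [Function.comp_def] using (hf.map (hinj false)).reverse
  · simp
  · simp

theorem exists_sequence (m : ℕ) :
    ∃ f : ℕ → Fin 35, IsSquareFree ((List.range (m + 1)).map fun t => f (t + 1)) := by
  obtain ⟨l, hl, hsq⟩ := exists_isSquareFree (Fin 35) (by simp) (m + 1)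
  -- Spine edges are numbered from 1, hence the shift; the default 0 is never used in the range
  -- considered.
  refine ⟨fun t => l.getD (t - 1) 0, ?_⟩
  convert hsq using 1
  refine List.ext_getElem (by simp [hl]) fun i h1 h2 => ?_
  simp [h2]

end Words

/-! ### Recovering the permutations from a form. -/

section Rigidity

variable {m : ℕ} {P R P' R' : Equiv.Perm ℕ}

/-- Positive letters occupy the same positions in both words, so `F` fixes those that occur. As it
commutes with inversion it fixes all letters that occur. -/
theorem formWord_eq_of_map (hP : Preserves m P) (hR : Preserves m R)
    {F : Equiv.Perm (Letter ℕ)} (hF : ∀ x, F x.inv = (F x).inv)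
    (h : (formWord m P R).map F = formWord m P' R') : formWord m P R = formWord m P' R' := by
  -- Erasing the names of inverse letters leaves a word independent of the permutations.
  let q : Letter ℕ → Option (Letter ℕ) := fun x => if x.2 then some x else none
  have hq : (formWord m P R).map (fun x => q (F x)) = (formWord m P R).map q := by
    have h1 : ∀ P R, (formWord m P R).map q = (boundary m 1 1).map fun a => q (codeLetter a) := by
      intro P R
      rw [← map_boundary_eq (P := P) (R := R) _ (by simp [q, codeLetter])]
      simp [formWord, Function.comp_def]
    rw [h1 P R, ← h1 P' R', ← h, List.map_map]
    rfl
  rw [List.map_inj_left] at hq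
  have hpos : ∀ x ∈ formWord m P R, x.2 = true → F x = x := by
    intro x hx h2
    have h3 := hq x hx
    simp only [q, h2, if_true] at h3
    split_ifs at h3
    exact Option.some.inj h3
  rw [← h]
  symm
  conv_rhs => rw [← List.map_id (formWord m P R)]
  refine List.map_inj_left.2 fun x hx => ?_
  cases h2 : x.2 with
  | true => exact hpos x hx h2
  | false =>
    have h3 := hpos x.inv (inv_mem_formWord hP hR hx) (by simp [Letter.inv, h2])
    rw [hF] at h3
    simpa only [Letter.inv_inv, id] using congrArg Letter.inv h3

/-- Equal words have equal successors: `P t` is read off after `z t`, and `R t` after the inverse of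
`x t`. -/
theorem eqOn_of_formWord_eq (hP : Preserves m P) (hR : Preserves m R) (hPR : Commute P R)
    (hPR' : Commute P' R') (h : formWord m P R = formWord m P' R') {t : ℕ} (ht : t ≤ m + 1) :
    P t = P' t ∧ R t = R' t := by
  have hb : boundary m P R = boundary m P' R' := List.map_injective_iff.2 codeLetter_injective h
  have hnext : ∀ a : Letter Edge, a.1.IsIn m → nextSide m P R a = nextSide m P' R' a := by
    intro a ha
    obtain ⟨i, rfl⟩ := List.get_of_mem ((mem_boundary hP hR a).2 ha)
    have h1 := get_finRotate_of_chain (chain_boundary (m := m) hPR) i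
    have h2 := hb ▸ chain_boundary (m := m) hPR'
    rw [← h1, get_finRotate_of_chain h2 i]
  constructor
  · simpa [nextSide] using hnext (.z t, true) ht
  · simpa [nextSide] using hnext (.x t, false) ht

end Rigidity

/-! ### Counting isomorphism classes by commuting pairs. -/

section Count

/-- Permutations of the handles, as permutations of the natural numbers. -/
def handlePerm (m : ℕ) : Equiv.Perm (Fin (m + 2)) →* Equiv.Perm ℕ :=
  Equiv.Perm.extendDomainHom Fin.equivSubtype

theorem handlePerm_apply {m : ℕ} (p : Equiv.Perm (Fin (m + 2))) (i : Fin (m + 2)) :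
    handlePerm m p i = p i :=
  Equiv.Perm.extendDomain_apply_image p Fin.equivSubtype i

theorem preserves_handlePerm {m : ℕ} (p : Equiv.Perm (Fin (m + 2))) :
    Preserves m (handlePerm m p) := by
  intro t
  by_cases ht : t < m + 2
  · have h := handlePerm_apply p ⟨t, ht⟩
    have := (p ⟨t, ht⟩).2
    simp only at h
    omega
  · have h : handlePerm m p t = t := Equiv.Perm.extendDomain_apply_not_subtype p _ ht
    rw [h]

/-- The form belonging to a commuting pair of permutations. -/
def pairForm (m : ℕ) (p : {p : Equiv.Perm (Fin (m + 2)) × Equiv.Perm (Fin (m + 2)) //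
    Commute p.1 p.2}) : List (Letter ℕ) :=
  formWord m (handlePerm m p.1.1) (handlePerm m p.1.2)

theorem pairForm_injective_of_map {m : ℕ} {p p' : {p : Equiv.Perm (Fin (m + 2)) ×
    Equiv.Perm (Fin (m + 2)) // Commute p.1 p.2}} {F : Equiv.Perm (Letter ℕ)}
    (hF : ∀ x, F x.inv = (F x).inv) (h : (pairForm m p).map F = pairForm m p') : p = p' := by
  have h1 := formWord_eq_of_map (preserves_handlePerm _) (preserves_handlePerm _) hF h
  have h2 : ∀ i : Fin (m + 2), p.1.1 i = p'.1.1 i ∧ p.1.2 i = p'.1.2 i := by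
    intro i
    have h3 := eqOn_of_formWord_eq (preserves_handlePerm _) (preserves_handlePerm _)
      (p.2.map (handlePerm m)) (p'.2.map (handlePerm m)) h1 (t := i) (by omega)
    simpa only [handlePerm_apply, Fin.val_inj] using h3
  exact Subtype.ext (Prod.ext (Equiv.ext fun i => (h2 i).1) (Equiv.ext fun i => (h2 i).2))

open Classical in
theorem card_fiber_pairForm_le {m : ℕ} [Fintype {p : Equiv.Perm (Fin (m + 2)) ×
    Equiv.Perm (Fin (m + 2)) // Commute p.1 p.2}] (I : Quotient isoSetoid) :
    (Finset.univ.filter fun p => Quotient.mk isoSetoid (pairForm m p) = I).card ≤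
      12 * m + 18 := by
  induction I using Quotient.inductionOn with
  | _ v =>
  -- A pair in the fiber is determined by the amount `k` by which the representative `v` has to be
  -- rotated: two pairs with the same `k` differ by a renaming of letters without rotation.
  have hk : ∀ p, ∃ k < 12 * m + 18, Quotient.mk isoSetoid (pairForm m p) = Quotient.mk isoSetoid v →
      ∃ F : Equiv.Perm (Letter ℕ), (∀ x, F x.inv = (F x).inv) ∧
        (pairForm m p).map F = v.rotate k := by
    intro p
    by_cases h : Quotient.mk isoSetoid (pairForm m p) = Quotient.mk isoSetoid v
    · obtain ⟨F, hF, hrot⟩ : Iso (pairForm m p) v := Quotient.exact h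
      have hlen : v.length = 12 * m + 18 := by
        rw [← hrot.perm.length_eq, List.length_map]
        exact length_formWord
      obtain ⟨k, hk⟩ := hrot.symm
      exact ⟨k % v.length, by rw [hlen]; exact Nat.mod_lt _ (by omega),
        fun _ => ⟨F, hF, by rw [List.rotate_mod, hk]⟩⟩
    · exact ⟨0, by omega, fun h' => absurd h' h⟩
  choose k hk hF using hk
  rw [← Finset.card_range (12 * m + 18)]
  refine Finset.card_le_card_of_injOn k (fun p _ => Finset.mem_coe.2 (Finset.mem_range.2 (hk p))) ?_
  intro p hp p' hp' h
  obtain ⟨F, hF1, hF2⟩ := hF p (by simpa using hp)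
  obtain ⟨F', hF1', hF2'⟩ := hF p' (by simpa using hp')
  refine pairForm_injective_of_map (F := F.trans F'.symm) (fun x => ?_) ?_
  · simp only [Equiv.trans_apply, Equiv.symm_apply_eq, hF1', Equiv.apply_symm_apply, hF1]
  · rw [Equiv.coe_trans, ← List.map_map, hF2, h, ← hF2', List.map_map]
    simp

/-- Permutations with `i` two-cycles and `j` three-cycles, for `i, j < k`, fit into `2i + 3j ≤ 5k`
points and have distinct cycle types. -/
theorem sq_le_card_conjClasses (n k : ℕ) (hk : 5 * k ≤ n) :
    k ^ 2 ≤ Nat.card (ConjClasses (Equiv.Perm (Fin n))) := by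
  have h : ∀ ij : Fin k × Fin k, ∃ g : Equiv.Perm (Fin n),
      g.cycleType = Multiset.replicate ij.1 2 + Multiset.replicate ij.2 3 := by
    intro ij
    rw [Equiv.Perm.exists_with_cycleType_iff]
    constructor
    · have h1 := ij.1.2
      have h2 := ij.2.2
      simp
      omega
    · intro a ha
      rw [Multiset.mem_add] at ha
      rcases ha with ha | ha <;> have := Multiset.eq_of_mem_replicate ha <;> omega
  choose g hg using h
  have hinj : Function.Injective fun ij => ConjClasses.mk (g ij) := by
    intro ij ij' h
    have h1 := Equiv.Perm.isConj_iff_cycleType_eq.1 (ConjClasses.mk_eq_mk_iff_isConj.1 h)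
    rw [hg, hg] at h1
    have h2 := congrArg (Multiset.count 2) h1
    have h3 := congrArg (Multiset.count 3) h1
    simp [Multiset.count_replicate] at h2 h3
    exact Prod.ext (Fin.ext h2) (Fin.ext h3)
  have := Nat.card_le_card_of_injective _ hinj
  simpa [sq] using this

theorem factorial_lt_M {m : ℕ} (hm : 10 ^ 17 < m + 2) (f : ℕ → Fin 35) :
    ((Nat.factorial (m + 2) : ℕ) : ℕ∞) < M (m + 2) (surfaceWord f m) := by
  classical
  have := Fintype.ofFinite {p : Equiv.Perm (Fin (m + 2)) × Equiv.Perm (Fin (m + 2)) //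
    Commute p.1 p.2}
  have h1 := Finset.card_le_mul_card_image
    (f := fun p => Quotient.mk isoSetoid (pairForm m p)) Finset.univ (12 * m + 18)
    (fun I _ => card_fiber_pairForm_le I)
  set S := Finset.univ.image fun p => Quotient.mk isoSetoid (pairForm m p) with hS
  have h2 : (S : Set (Quotient isoSetoid)).encard ≤ M (m + 2) (surfaceWord f m) := by
    refine Set.encard_le_encard fun I hI => ?_
    obtain ⟨p, -, rfl⟩ := Finset.mem_image.1 (Finset.mem_coe.1 hI)
    have hc := p.2.map (handlePerm m)
    have hp := preserves_handlePerm p.1.1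
    have hr := preserves_handlePerm p.1.2
    exact ⟨pairForm m p, rfl, isMaximalWicksForm_formWord hp hr hc, _,
      isNonCancelling_surfaceWord hp hr hc⟩
  rw [Set.encard_coe_eq_coe_finsetCard] at h2
  refine lt_of_lt_of_le (Nat.cast_lt.2 ?_) h2
  -- The number of commuting pairs in a finite group is its order times its number of conjugacy
  -- classes.
  rw [Finset.card_univ, ← Nat.card_eq_fintype_card, card_comm_eq_card_conjClasses_mul_card,
    Nat.card_perm, Nat.card_fin] at h1
  have h3 := sq_le_card_conjClasses (m + 2) ((m + 2) / 5) (by omega)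
  have h4 : 12 * m + 18 < ((m + 2) / 5) ^ 2 := by
    -- The quadratic bound only has to exceed `12g - 6`; the assumed size of `g` is far larger than
    -- this needs.
    have h5 : 100 ≤ (m + 2) / 5 := by omega
    have h6 : 100 * ((m + 2) / 5) ≤ ((m + 2) / 5) ^ 2 := by
      rw [sq]
      exact Nat.mul_le_mul_right _ h5
    omega
  by_contra hcon
  have h7 : (12 * m + 18) * S.card ≤ (12 * m + 18) * Nat.factorial (m + 2) :=
    Nat.mul_le_mul_left _ (not_lt.1 hcon)
  have h8 := Nat.mul_lt_mul_of_pos_right (h4.trans_le h3) (Nat.factorial_pos (m + 2))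
  omega

end Count

end Wicks

theorem mainTheorem2 :
    ∃ w : ℕ → List (Wicks.Letter (Fin 40)), ∀ g : ℕ, 2 ≤ g →
      (∀ w' : List (Wicks.Letter (Fin 40)), w' ~r w g → Wicks.IsSquareFree w') ∧
      Wicks.HasGenus (w g) g ∧
      (10 ^ 17 < g → ((Nat.factorial g : ℕ) : ℕ∞) < Wicks.M g (w g)) := by
  choose f hf using Wicks.exists_sequence
  refine ⟨fun g => Wicks.surfaceWord (f (g - 2)) (g - 2), fun g hg => ?_⟩
  obtain ⟨m, rfl⟩ : ∃ m, g = m + 2 := ⟨g - 2, by omega⟩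
  simp only [Nat.add_sub_cancel]
  exact ⟨fun w' hw' => Wicks.isSquareFree_surfaceWord (hf m) hw', Wicks.hasGenus_surfaceWord,
    fun hm => Wicks.factorial_lt_M hm _⟩
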